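/- **Proposition.** *Model.* Let $b_1>b_2>b_3>\cdots\ge 0$ with $b_\infty=0$, let $0\le\gamma<1$, and let $c,c_0$ be real numbers. In a finite undirected network $g$ write $d_j$ for the degree of node $j$, $l(y,z)$ for the shortest-path distance ($\infty$ if $y,z$ are not connected), and $E(y,z)$ for the set of nodes other than $y,z$ that lie on every path joining $y$ and $z$. The utility of node $j$ is $$u_j(g)=d_j(b_1-c)+\sum_{w:\,l(j,w)>1} b_{l(j,w)}-\sum_{w:\,E(j,w)\ne\emptyset}\gamma\, b_{l(j,w)}+\sum_{\{y,z\}:\,j\in E(y,z)}\frac{\gamma}{|E(y,z)|}\,2\,b_{l(y,z)},$$ where pairs in different components contribute $0$. A newly entering node that makes its first link with a node $t$ in addition pays, at that moment, the entry fee $c_0 d_t$, where $d_t$ is the degree of $t$ before the link is made; its utility when it stays out is $0$. A network is *pairwise stable* if no node strictly gains by deleting one of its links, and for every missing link $\{i,j\}$, if $i$ strictly gains from creating it then $j$ strictly loses. *Formation process.* The process starts with a single node. When the current network on $n$ nodes is pairwise stable, a new node considers entering: among the existing nodes whose utility would not decrease by accepting its link, it links to one that gives it the largest utility (net of the fee),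 provided this utility is strictly positive; otherwise it stays out. After an entry the network on $n+1$ nodes evolves: one node at a time gets to move and plays a myopic best response among keeping the status quo, deleting one of its links, or creating one missing link that does not decrease the utility of the other end; it alters a link only if this strictly increases its own utility, and ties are broken arbitrarily. The evolution goes on until a pairwise stable network is reached, whereupon the next node considers entering. *Claim.* Suppose $$\gamma<\frac{b_2-b_3}{3b_2-b_3},\qquad b_1-b_2+\gamma(3b_2-b_3)<c<b_1-b_3,\qquad (1-\gamma)(b_2-b_3)<c_0\le(1-\gamma)b_2 .$$ Then the unique topology that results is the bipartite Turán graph. That is, for every $n\ge1$: 1. some pairwise stable network on $n$ nodes can result from the process; 2. every pairwise stable network on $n$ nodes that can result from the process, for any order of moves and any tie-breaking, is isomorphic to the bipartite Turán graph on $n$ nodes (the complete bipartite graph with parts of sizes $\lceil n/2\rceil$ and $\lfloor n/2\rfloor$); 3. from each such network the next node does enter, and after any best-response entry, every evolution in which each node gets to move infinitely often (which holds almost surely when the movers are drawn independently and uniformly at random) becomes constant after finitely many moves, at a pairwise stable network isomorphic to the bipartite Turán graph on $n+1$ nodes. -/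

import Mathlib

/-- The (raw) parameters of the network formation model: `b i` is the benefit from a node at
distance `i ≥ 1` in the absence of rents, `γ` is the fraction of an indirect benefit paid as
intermediation rent, `c` is the cost of maintaining a link, `c₀` is the network entry factor. -/
structure NetParams where
  b : ℕ → ℝ
  γ : ℝ
  c : ℝ
  c₀ : ℝ

namespace NetFormation

open SimpleGraph

/-- The benefit at a given distance; nodes in different components give benefit `b_∞ = 0`. -/
noncomputable def benefit (P : NetParams) (d : ℕ∞) : ℝ :=
  if d = ⊤ then 0 else P.b d.toNat

open Classical in
/-- The set `E(y, z)` of essential nodes connecting `y` and `z`: the nodes other than `y`, `z`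
that lie on every path joining them. (For `y`, `z` in different components the condition is
vacuous, but such pairs carry benefit `b_∞ = 0` and never contribute to a utility.) -/
noncomputable def essential {V : Type*} [Fintype V] (G : SimpleGraph V) (y z : V) : Finset V :=
  {j | j ≠ y ∧ j ≠ z ∧ ∀ p : G.Walk y z, p.IsPath → j ∈ p.support}

open Classical in
/-- The utility of node `j` in the network `G`, without the one-time entry fee: net direct
benefits, plus indirect benefits, minus intermediation rents, plus bridging benefits.
The bridging sum runs over ordered pairs `(y, z)`, so that every unordered pair `{y, z}`
is counted twice and contributes `(γ / |E(y,z)|) * 2 * b_{l(y,z)}`. -/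
noncomputable def utility {V : Type*} [Fintype V] (P : NetParams) (G : SimpleGraph V) (j : V) :
    ℝ :=
  (G.degree j : ℝ) * (P.b 1 - P.c)
    + (∑ w : V, if 1 < G.edist j w then benefit P (G.edist j w) else 0)
    - (∑ w : V, if (essential G j w).Nonempty then P.γ * benefit P (G.edist j w) else 0)
    + ∑ y : V, ∑ z : V, if j ∈ essential G y z then
        P.γ / ((essential G y z).card : ℝ) * benefit P (G.edist y z) else 0

/-- The network obtained by creating the link `{i, j}`. -/
def addLink {V : Type*} (G : SimpleGraph V) (i j : V) : SimpleGraph V :=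
  G ⊔ SimpleGraph.edge i j

/-- The network obtained by deleting the link `{i, j}`. -/
def deleteLink {V : Type*} (G : SimpleGraph V) (i j : V) : SimpleGraph V :=
  G.deleteEdges {s(i, j)}

/-- Pairwise stability: no node gains by deleting one of its links, and for every missing link,
if one end strictly gains from creating it then the other end strictly loses. -/
def PairwiseStable {V : Type*} [Fintype V] (P : NetParams) (G : SimpleGraph V) : Prop :=
  (∀ i j, G.Adj i j → utility P (deleteLink G i j) i ≤ utility P G i) ∧
  (∀ i j, i ≠ j → ¬ G.Adj i j → utility P G i < utility P (addLink G i j) i →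
    utility P (addLink G i j) j < utility P G j)

/-- The outcomes of the strategies available to node `i` when it gets to move at `G`: keep the
status quo, delete one link, or create one link that does not decrease the utility of the
other end (who would otherwise refuse it). -/
inductive MoveOption {V : Type*} [Fintype V] (P : NetParams) (G : SimpleGraph V) (i : V) :
    SimpleGraph V → Prop
  | stay : MoveOption P G i G
  | create (j : V) : i ≠ j → ¬ G.Adj i j → utility P G j ≤ utility P (addLink G i j) j →
      MoveOption P G i (addLink G i j)
  | delete (j : V) : G.Adj i j → MoveOption P G i (deleteLink G i j)

/-- `H` is the outcome of a myopic best response of node `i` at `G`. A node that cannot strictly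
increase its utility does not alter any link; ties between best alterations are broken
arbitrarily. -/
def BestResponse {V : Type*} [Fintype V] (P : NetParams) (G : SimpleGraph V) (i : V)
    (H : SimpleGraph V) : Prop :=
  MoveOption P G i H ∧ (∀ H', MoveOption P G i H' → utility P H' i ≤ utility P H i) ∧
    (utility P H i ≤ utility P G i → H = G)

/-- The network after a new node (`Fin.last n`) has entered the network `G` by creating
its first link with the node `t`. -/
def enter {n : ℕ} (G : SimpleGraph (Fin n)) (t : Fin n) : SimpleGraph (Fin (n + 1)) :=
  addLink (G.map Fin.castSucc) (Fin.last n) t.castSucc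

/-- The existing node `t` accepts the link proposed by the entering node: its utility does not
decrease. -/
def AcceptsEntry {n : ℕ} (P : NetParams) (G : SimpleGraph (Fin n)) (t : Fin n) : Prop :=
  utility P G t ≤ utility P (enter G t) t.castSucc

open Classical in
/-- The utility of the entering node when it creates its first link with `t`; it pays the entry
fee `c₀` times the degree of `t`. -/
noncomputable def entryUtility {n : ℕ} (P : NetParams) (G : SimpleGraph (Fin n)) (t : Fin n) :
    ℝ :=
  utility P (enter G t) (Fin.last n) - P.c₀ * (G.degree t : ℝ)

/-- Entering through `t` is a best response of the new node: `t` accepts, no other accepting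
node is better, and the resulting utility is strictly larger than the utility `0` of staying
out. -/
def BestEntry {n : ℕ} (P : NetParams) (G : SimpleGraph (Fin n)) (t : Fin n) : Prop :=
  AcceptsEntry P G t ∧ (∀ s, AcceptsEntry P G s → entryUtility P G s ≤ entryUtility P G t) ∧
    0 < entryUtility P G t

/-- `Emerges P n G`: the recursive formation process, started with a single node, can arrive at
the stable network `G` on `n` nodes. From a stable network on `n` nodes a new node enters by a
best response, after which the network evolves by myopic best responses of nodes moving in
any order, until a stable network on `n + 1` nodes is reached. -/
inductive Emerges (P : NetParams) : (n : ℕ) → SimpleGraph (Fin n) → Prop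
  | base : Emerges P 1 ⊥
  | grow {n : ℕ} {G : SimpleGraph (Fin n)} {t : Fin n} {H : SimpleGraph (Fin (n + 1))} :
      Emerges P n G → BestEntry P G t →
      Relation.ReflTransGen (fun A B => ∃ i, BestResponse P A i B) (enter G t) H →
      PairwiseStable P H → Emerges P (n + 1) H

/-- A run of the evolution phase from `G`: at time `k` the node `m k` gets to move and plays a
best response, leading from the network `g k` to `g (k + 1)`. -/
def IsRun {V : Type*} [Fintype V] (P : NetParams) (G : SimpleGraph V) (m : ℕ → V)
    (g : ℕ → SimpleGraph V) : Prop :=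
  g 0 = G ∧ ∀ k, BestResponse P (g k) (m k) (g (k + 1))

/-- Every node gets to move infinitely often. (If the movers are drawn independently and
uniformly at random, this holds almost surely.) -/
def FairSchedule {V : Type*} (m : ℕ → V) : Prop :=
  ∀ i T, ∃ k, T ≤ k ∧ m k = i

end NetFormation

/-!
Write a network right after an entry as follows: the old nodes form a complete bipartite network
with classes `A` and `B`, where `|A| ≤ |B| + 1`, and the entrant `v` is linked to a nonempty set
`S ⊆ A`. The whole evolution takes place among these networks (`stage`, `Attaching`), and it
consists in enlarging `S` until `S = A`. Three observations give this.

* In a bipartite network no deletion pays, and any link between nodes at distance at least `3` pays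
  for both ends, because `b₁ - c > b₃` while no distance or rent of the node in question moves the
  wrong way. The pairs mediated by a node do not depend on its own links, and adding links only
  raises its share and shortens the distance of those pairs (`utility_lt_addLink_of_three_le`,
  `utility_deleteLink_lt`).
* Every other possible new link joins two nodes of the same class at distance `2`, and harms one of
  its ends (`Attaching.utility_addLink_lt_or`). That end gains `b₁ - c`, which is less than
  `b₂ - γ (3 b₂ - b₃)`. It loses an indirect benefit of at least `(1 - γ) b₂`, its connections to
  third nodes are unaffected, and its bridging benefits grow by at most `γ (2 b₂ - b₃)`. The last
  bound is attained by an inner node of a path on four nodes that is linked to the far end: its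
  share in the pair of end nodes goes from one half of `2 γ b₃` to the whole of `2 γ b₂`.
* Hence a best response either changes nothing or links `v` to a further node of `A`, the entrant
  does not rest before `S = A`, and the network with `S = A` is the only stable one.

It remains to see that `v` enters through the larger class, so that the class it joins is the
smaller one. Through a node of a class of size `p`, opposite to one of size `q`, the entrant earns
`b₁ - c + q ((1 - γ) b₂ - c₀) + (p - 1) (1 - γ) b₃`, and `(1 - γ) b₂ - c₀ < (1 - γ) b₃` makes a
larger `p` preferable (`IsBalanced.card_le_of_bestEntry`). All nodes accept the
entrant, as it comes from another component.
-/

namespace NetFormation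

open SimpleGraph

section Graph

variable {V : Type*}

/-! ### Short distances -/

theorem one_le_edist {G : SimpleGraph V} {i j : V} (h : i ≠ j) : 1 ≤ G.edist i j :=
  Order.one_le_iff_pos.2 (edist_pos_of_ne h)

theorem two_le_edist {G : SimpleGraph V} {i j : V} (h : i ≠ j) (hadj : ¬ G.Adj i j) :
    2 ≤ G.edist i j := by
  have h1 : 1 < G.edist i j := by
    by_contra hc
    rcases edist_le_one_iff_adj_or_eq.1 (not_lt.1 hc) with h' | h'
    · exact hadj h'
    · exact h h'
  have := Order.add_one_le_of_lt h1
  simpa [one_add_one_eq_two] using this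

theorem one_lt_edist {G : SimpleGraph V} {i j : V} (h : i ≠ j) (hadj : ¬ G.Adj i j) :
    1 < G.edist i j :=
  lt_of_lt_of_le (by norm_num) (two_le_edist h hadj)

theorem three_le_edist {G : SimpleGraph V} {i j : V} (h : i ≠ j) (hadj : ¬ G.Adj i j)
    (hcommon : ∀ w, G.Adj i w → ¬ G.Adj w j) : 3 ≤ G.edist i j := by
  have h1 : 2 < G.edist i j := by
    refine lt_of_le_of_ne (two_le_edist h hadj) fun h2 => ?_
    obtain ⟨-, -, w, hw⟩ := edist_eq_two_iff.1 h2.symm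
    rw [mem_commonNeighbors] at hw
    exact hcommon w hw.1 hw.2.symm
  have := Order.add_one_le_of_lt h1
  simpa [two_add_one_eq_three] using this

theorem edist_le_two {G : SimpleGraph V} {i j k : V} (h₁ : G.Adj i k) (h₂ : G.Adj k j) :
    G.edist i j ≤ 2 := by
  simpa using edist_le (Walk.cons h₁ (Walk.cons h₂ Walk.nil))

theorem edist_le_three {G : SimpleGraph V} {i j k l : V} (h₁ : G.Adj i k) (h₂ : G.Adj k l)
    (h₃ : G.Adj l j) : G.edist i j ≤ 3 := by
  simpa using edist_le (Walk.cons h₁ (Walk.cons h₂ (Walk.cons h₃ Walk.nil)))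

/-! ### Walks avoiding a node -/

/-- Two nodes are linked by a walk that avoids `i`. -/
def JoinedAvoiding (G : SimpleGraph V) (i y z : V) : Prop :=
  ∃ p : G.Walk y z, i ∉ p.support

theorem JoinedAvoiding.symm {G : SimpleGraph V} {i y z : V} (h : JoinedAvoiding G i y z) :
    JoinedAvoiding G i z y := by
  obtain ⟨p, hp⟩ := h
  exact ⟨p.reverse, by simpa using hp⟩

theorem JoinedAvoiding.trans {G : SimpleGraph V} {i x y z : V} (h : JoinedAvoiding G i x y)
    (h' : JoinedAvoiding G i y z) : JoinedAvoiding G i x z := by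
  obtain ⟨p, hp⟩ := h
  obtain ⟨q, hq⟩ := h'
  exact ⟨p.append q, by simp [Walk.mem_support_append_iff, hp, hq]⟩

theorem JoinedAvoiding.refl {G : SimpleGraph V} {i y : V} (h : y ≠ i) :
    JoinedAvoiding G i y y :=
  ⟨Walk.nil, by simpa using h.symm⟩

theorem JoinedAvoiding.of_adj {G : SimpleGraph V} {i y z : V} (hy : y ≠ i) (hz : z ≠ i)
    (h : G.Adj y z) : JoinedAvoiding G i y z :=
  ⟨Walk.cons h Walk.nil, by simp [hy.symm, hz.symm]⟩

/-! ### Creating and deleting a link -/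

theorem addLink_adj {G : SimpleGraph V} {i j x y : V} (hij : i ≠ j) :
    (addLink G i j).Adj x y ↔ G.Adj x y ∨ (x = i ∧ y = j) ∨ (x = j ∧ y = i) := by
  simp only [addLink, sup_adj, edge_adj]
  constructor
  · rintro (h | ⟨h, -⟩)
    · exact Or.inl h
    · exact Or.inr h
  · rintro (h | h)
    · exact Or.inl h
    · refine Or.inr ⟨h, ?_⟩
      rcases h with ⟨rfl, rfl⟩ | ⟨rfl, rfl⟩
      · exact hij
      · exact hij.symm

theorem addLink_comm (G : SimpleGraph V) (i j : V) : addLink G i j = addLink G j i := by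
  simp [addLink, edge_comm]

theorem le_addLink (G : SimpleGraph V) (i j : V) : G ≤ addLink G i j := le_sup_left

theorem addLink_adj_self {G : SimpleGraph V} {i j : V} (hij : i ≠ j) : (addLink G i j).Adj i j :=
  (addLink_adj hij).2 (Or.inr (Or.inl ⟨rfl, rfl⟩))

theorem deleteLink_adj {G : SimpleGraph V} {i j x y : V} :
    (deleteLink G i j).Adj x y ↔ G.Adj x y ∧ ¬ ((x = i ∧ y = j) ∨ (x = j ∧ y = i)) := by
  simp [deleteLink, deleteEdges_adj]

theorem addLink_deleteLink {G : SimpleGraph V} {i j : V} (h : G.Adj i j) :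
    addLink (deleteLink G i j) i j = G := by
  ext x y
  rw [addLink_adj h.ne, deleteLink_adj]
  constructor
  · rintro (⟨h', -⟩ | ⟨rfl, rfl⟩ | ⟨rfl, rfl⟩)
    · exact h'
    · exact h
    · exact h.symm
  · intro h'
    by_cases hc : (x = i ∧ y = j) ∨ (x = j ∧ y = i)
    · exact Or.inr hc
    · exact Or.inl ⟨h', hc⟩

end Graph

/-! ### The terms of the utility -/

/-- The standing assumptions on the benefits, the rent fraction and the link cost (the entry factor
`c₀` plays no role once a node has entered). -/
structure Admissible (P : NetParams) : Prop where
  nonneg : ∀ i, 1 ≤ i → 0 ≤ P.b i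
  decay : ∀ i, 1 ≤ i → P.b (i + 1) < P.b i
  rent_nonneg : 0 ≤ P.γ
  rent_lt_one : P.γ < 1
  cost_lower : P.b 1 - P.b 2 + P.γ * (3 * P.b 2 - P.b 3) < P.c
  cost_upper : P.c < P.b 1 - P.b 3

section Utility

variable {V : Type*} [Fintype V] {P : NetParams}

open Classical in
/-- The indirect benefit that node `i` draws from node `w`, net of the intermediation rent. -/
noncomputable def netBenefit (P : NetParams) (G : SimpleGraph V) (i w : V) : ℝ :=
  (if 1 < G.edist i w then benefit P (G.edist i w) else 0) -
    (if (essential G i w).Nonempty then P.γ * benefit P (G.edist i w) else 0)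

open Classical in
/-- The bridging benefit that node `i` draws from the ordered pair `(y, z)`. -/
noncomputable def bridging (P : NetParams) (G : SimpleGraph V) (i y z : V) : ℝ :=
  if i ∈ essential G y z then P.γ / ((essential G y z).card : ℝ) * benefit P (G.edist y z) else 0

open Classical in
theorem utility_eq (P : NetParams) (G : SimpleGraph V) (i : V) :
    utility P G i = (G.degree i : ℝ) * (P.b 1 - P.c) + ∑ w, netBenefit P G i w
      + ∑ y, ∑ z, bridging P G i y z := by
  simp only [utility, netBenefit, bridging, Finset.sum_sub_distrib]
  ring

theorem benefit_nonneg (hP : Admissible P) {d : ℕ∞} (hd : 1 ≤ d) : 0 ≤ benefit P d := by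
  unfold benefit
  split_ifs with h
  · exact le_rfl
  · lift d to ℕ using h
    exact hP.nonneg _ (by simpa using hd)

theorem Admissible.b_antitone (hP : Admissible P) {m n : ℕ} (hm : 1 ≤ m) (hmn : m ≤ n) :
    P.b n ≤ P.b m := by
  induction n, hmn using Nat.le_induction with
  | base => exact le_rfl
  | succ k hk ih => exact (hP.decay k (hm.trans hk)).le.trans ih

theorem benefit_antitone (hP : Admissible P) {d e : ℕ∞} (hd : 1 ≤ d) (hde : d ≤ e) :
    benefit P e ≤ benefit P d := by
  by_cases he : e = ⊤
  · subst he
    simpa [benefit] using benefit_nonneg hP hd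
  · have hd' : d ≠ ⊤ := fun h => he (top_le_iff.1 (h ▸ hde))
    lift e to ℕ using he
    lift d to ℕ using hd'
    simpa [benefit] using hP.b_antitone (by simpa using hd) (by simpa using hde)

theorem benefit_two : benefit P 2 = P.b 2 := by
  simp [benefit]

theorem benefit_three : benefit P 3 = P.b 3 := by
  simp [benefit]

/-! ### Essential nodes -/

theorem mem_essential {G : SimpleGraph V} {i y z : V} :
    i ∈ essential G y z ↔ i ≠ y ∧ i ≠ z ∧ ∀ p : G.Walk y z, i ∈ p.support := by
  classical
  unfold essential
  simp only [Finset.mem_filter, Finset.mem_univ, true_and]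
  refine and_congr_right fun _ => and_congr_right fun _ => ⟨fun h p => ?_, fun h p _ => h p⟩
  exact p.support_bypass_subset_support (h _ p.bypass_isPath)

theorem essential_comm (G : SimpleGraph V) (y z : V) : essential G y z = essential G z y := by
  ext i
  simp only [mem_essential]
  constructor
  · rintro ⟨h1, h2, h⟩
    exact ⟨h2, h1, fun p => by simpa using h p.reverse⟩
  · rintro ⟨h1, h2, h⟩
    exact ⟨h2, h1, fun p => by simpa using h p.reverse⟩

theorem essential_self (G : SimpleGraph V) (y : V) : essential G y y = ∅ := by
  ext i
  simp only [mem_essential, Finset.notMem_empty, iff_false]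
  rintro ⟨h, -, hp⟩
  exact h (by simpa using hp Walk.nil)

theorem essential_of_adj {G : SimpleGraph V} {y z : V} (h : G.Adj y z) : essential G y z = ∅ := by
  ext i
  simp only [mem_essential, Finset.notMem_empty, iff_false]
  rintro ⟨h1, h2, hp⟩
  have := hp (Walk.cons h Walk.nil)
  simp [h1, h2] at this

theorem essential_anti {G H : SimpleGraph V} (h : G ≤ H) (y z : V) :
    essential H y z ⊆ essential G y z := by
  intro i
  simp only [mem_essential]
  rintro ⟨h1, h2, hp⟩
  exact ⟨h1, h2, fun p => by simpa using hp (p.mapLe h)⟩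

theorem eq_of_mem_essential_two {G : SimpleGraph V} {i y z k : V} (h₁ : G.Adj y k)
    (h₂ : G.Adj k z) (hi : i ∈ essential G y z) : i = k := by
  obtain ⟨h1, h2, hp⟩ := mem_essential.1 hi
  have := hp (Walk.cons h₁ (Walk.cons h₂ Walk.nil))
  simpa [h1, h2] using this

theorem eq_of_mem_essential_three {G : SimpleGraph V} {i y z k l : V} (h₁ : G.Adj y k)
    (h₂ : G.Adj k l) (h₃ : G.Adj l z) (hi : i ∈ essential G y z) : i = k ∨ i = l := by
  obtain ⟨h1, h2, hp⟩ := mem_essential.1 hi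
  have := hp (Walk.cons h₁ (Walk.cons h₂ (Walk.cons h₃ Walk.nil)))
  simpa [h1, h2] using this

/-- The only neighbour of a node is essential for every connection to that node. -/
theorem mem_essential_of_pendant {G : SimpleGraph V} {i w t : V} (hiw : i ≠ w) (hit : i ≠ t)
    (hwt : w ≠ t) (h : ∀ x, G.Adj w x → x = t) : t ∈ essential G i w := by
  refine mem_essential.2 ⟨hit.symm, hwt.symm, fun p => ?_⟩
  have hp : ¬ p.Nil := fun hn => hiw hn.eq
  have := h _ (p.adj_penultimate hp).symm
  exact this ▸ p.getVert_mem_support _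

theorem not_mem_essential_of_joined {G : SimpleGraph V} {i y z : V}
    (h : JoinedAvoiding G i y z) : i ∉ essential G y z := by
  obtain ⟨p, hp⟩ := h
  exact fun hi => hp ((mem_essential.1 hi).2.2 p)

/-- If every node other than `i` and `u` is joined to a common node by a walk avoiding `i`, then `i`
mediates only pairs that contain `u`. -/
theorem eq_or_eq_of_mem_essential {G : SimpleGraph V} {i u o : V}
    (h : ∀ y, y ≠ i → y ≠ u → JoinedAvoiding G i y o) {y z : V} (hi : i ∈ essential G y z) :
    y = u ∨ z = u := by
  by_contra! hc
  obtain ⟨h1, h2, -⟩ := mem_essential.1 hi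
  exact not_mem_essential_of_joined ((h y h1.symm hc.1).trans (h z h2.symm hc.2).symm) hi

theorem not_mem_essential_of_hub {G : SimpleGraph V} {i o : V}
    (h : ∀ y, y ≠ i → JoinedAvoiding G i y o) (y z : V) : i ∉ essential G y z := by
  intro hi
  obtain ⟨h1, h2, -⟩ := mem_essential.1 hi
  exact not_mem_essential_of_joined ((h y h1.symm).trans (h z h2.symm).symm) hi

/-! ### The effect of a new link on the utility -/

open Classical in
theorem degree_addLink {G : SimpleGraph V} {i j : V} (hij : i ≠ j) (hadj : ¬ G.Adj i j) :
    (addLink G i j).degree i = G.degree i + 1 := by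
  rw [← card_neighborFinset_eq_degree, ← card_neighborFinset_eq_degree]
  have : (addLink G i j).neighborFinset i = insert j (G.neighborFinset i) := by
    ext x
    simp only [mem_neighborFinset, addLink_adj hij, Finset.mem_insert]
    constructor
    · rintro (h | ⟨-, h⟩ | ⟨h, -⟩)
      · exact Or.inr h
      · exact Or.inl h
      · exact absurd h hij
    · rintro (h | h)
      · exact Or.inr (Or.inl ⟨trivial, h⟩)
      · exact Or.inl h
  rw [this, Finset.card_insert_of_notMem (by simpa using hadj)]

/-- Whether `i` mediates a pair does not depend on the links of `i` itself. -/
theorem mem_essential_addLink {G : SimpleGraph V} {i j y z : V} (hij : i ≠ j) :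
    i ∈ essential (addLink G i j) y z ↔ i ∈ essential G y z := by
  refine ⟨fun h => essential_anti (le_addLink G i j) y z h, fun h => ?_⟩
  obtain ⟨h1, h2, hp⟩ := mem_essential.1 h
  refine mem_essential.2 ⟨h1, h2, fun p => ?_⟩
  by_contra hi
  have hpe : ∀ e ∈ p.edges, e ∈ G.edgeSet := by
    intro e he
    induction e with
    | _ a b =>
      have hab := p.adj_of_mem_edges he
      rcases (addLink_adj hij).1 hab with h' | ⟨rfl, rfl⟩ | ⟨rfl, rfl⟩
      · exact h'
      · exact absurd (p.fst_mem_support_of_mem_edges he) hi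
      · exact absurd (p.snd_mem_support_of_mem_edges he) hi
  have := hp (p.transfer G hpe)
  rw [Walk.support_transfer] at this
  exact hi this

theorem netBenefit_self (G : SimpleGraph V) (i : V) : netBenefit P G i i = 0 := by
  simp [netBenefit, essential_self]

theorem netBenefit_of_adj {G : SimpleGraph V} {i w : V} (h : G.Adj i w) :
    netBenefit P G i w = 0 := by
  simp [netBenefit, essential_of_adj h, edist_eq_one_iff_adj.2 h]

theorem netBenefit_of_nonempty {G : SimpleGraph V} {i w : V} (h : i ≠ w) (hadj : ¬ G.Adj i w)
    (hE : (essential G i w).Nonempty) :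
    netBenefit P G i w = (1 - P.γ) * benefit P (G.edist i w) := by
  rw [netBenefit, if_pos (one_lt_edist h hadj), if_pos hE]
  ring

theorem netBenefit_of_empty {G : SimpleGraph V} {i w : V} (h : i ≠ w) (hadj : ¬ G.Adj i w)
    (hE : ¬ (essential G i w).Nonempty) :
    netBenefit P G i w = benefit P (G.edist i w) := by
  rw [netBenefit, if_pos (one_lt_edist h hadj), if_neg hE, sub_zero]

theorem netBenefit_le_benefit (hP : Admissible P) {G : SimpleGraph V} {i w : V} (h : i ≠ w)
    (hadj : ¬ G.Adj i w) : netBenefit P G i w ≤ benefit P (G.edist i w) := by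
  have h0 := benefit_nonneg hP (one_le_edist (G := G) h)
  by_cases hE : (essential G i w).Nonempty
  · rw [netBenefit_of_nonempty h hadj hE]
    nlinarith [mul_nonneg hP.rent_nonneg h0]
  · rw [netBenefit_of_empty h hadj hE]

theorem le_netBenefit (hP : Admissible P) {G : SimpleGraph V} {i w : V} (h : i ≠ w)
    (hadj : ¬ G.Adj i w) : (1 - P.γ) * benefit P (G.edist i w) ≤ netBenefit P G i w := by
  have h0 := benefit_nonneg hP (one_le_edist (G := G) h)
  by_cases hE : (essential G i w).Nonempty
  · rw [netBenefit_of_nonempty h hadj hE]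
  · rw [netBenefit_of_empty h hadj hE]
    nlinarith [mul_nonneg hP.rent_nonneg h0]

/-- Net indirect benefits decrease when the distance increases and a rent becomes due. -/
theorem netBenefit_mono (hP : Admissible P) {G H : SimpleGraph V} {i w : V} (h : i ≠ w)
    (hG : ¬ G.Adj i w) (hH : ¬ H.Adj i w) (hd : H.edist i w ≤ G.edist i w)
    (hE : (essential H i w).Nonempty → (essential G i w).Nonempty) :
    netBenefit P G i w ≤ netBenefit P H i w := by
  have hb := benefit_antitone hP (one_le_edist (G := H) h) hd
  by_cases hEH : (essential H i w).Nonempty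
  · rw [netBenefit_of_nonempty h hG (hE hEH), netBenefit_of_nonempty h hH hEH]
    exact mul_le_mul_of_nonneg_left hb (sub_nonneg.2 hP.rent_lt_one.le)
  · rw [netBenefit_of_empty h hH hEH]
    exact (netBenefit_le_benefit hP h hG).trans hb

theorem bridging_nonneg (hP : Admissible P) (G : SimpleGraph V) (i y z : V) :
    0 ≤ bridging P G i y z := by
  unfold bridging
  split_ifs with h
  · have hyz : y ≠ z := by
      rintro rfl
      simp [essential_self] at h
    exact mul_nonneg (div_nonneg hP.rent_nonneg (Nat.cast_nonneg _))
      (benefit_nonneg hP (one_le_edist hyz))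
  · exact le_rfl

theorem bridging_le_addLink (hP : Admissible P) {G : SimpleGraph V} {i j : V} (hij : i ≠ j)
    (y z : V) : bridging P G i y z ≤ bridging P (addLink G i j) i y z := by
  by_cases h : i ∈ essential G y z
  · have h' := (mem_essential_addLink (j := j) hij).2 h
    have hyz : y ≠ z := by
      rintro rfl
      simp [essential_self] at h
    rw [bridging, bridging, if_pos h, if_pos h']
    have hpos : 0 < (essential (addLink G i j) y z).card := Finset.card_pos.2 ⟨i, h'⟩
    have hcard : (essential (addLink G i j) y z).card ≤ (essential G y z).card :=
      Finset.card_le_card (essential_anti (le_addLink G i j) y z)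
    refine mul_le_mul ?_ ?_ ?_ ?_
    · exact div_le_div_of_nonneg_left hP.rent_nonneg (by exact_mod_cast hpos)
        (by exact_mod_cast hcard)
    · exact benefit_antitone hP (one_le_edist hyz) (edist_anti (le_addLink G i j))
    · exact benefit_nonneg hP (one_le_edist hyz)
    · exact div_nonneg hP.rent_nonneg (Nat.cast_nonneg _)
  · rw [bridging, if_neg h]
    exact bridging_nonneg hP _ _ _ _

/-- Linking to a node at distance at least `3` pays: the direct benefit `b₁ - c` exceeds the
indirect benefit `b₃`, no other distance or rent grows, and the set of pairs mediated is
unchanged. -/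
theorem utility_lt_addLink_of_three_le (hP : Admissible P) {G : SimpleGraph V} {i j : V}
    (hd : 3 ≤ G.edist i j) : utility P G i < utility P (addLink G i j) i := by
  classical
  have hij : i ≠ j := by
    rintro rfl
    simp at hd
  have hadj : ¬ G.Adj i j := by
    intro h
    rw [edist_eq_one_iff_adj.2 h] at hd
    norm_num at hd
  rw [utility_eq, utility_eq, degree_addLink hij hadj]
  have h1 : ∑ w, netBenefit P G i w ≤
      ∑ w, (netBenefit P (addLink G i j) i w + if w = j then P.b 3 else 0) := by
    refine Finset.sum_le_sum fun w _ => ?_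
    by_cases hwj : w = j
    · subst hwj
      rw [if_pos rfl, netBenefit_of_adj (addLink_adj_self hij), zero_add]
      refine (netBenefit_le_benefit hP hij hadj).trans ?_
      simpa [benefit_three] using benefit_antitone hP (by norm_num) hd
    · rw [if_neg hwj, add_zero]
      by_cases hwi : w = i
      · subst hwi
        simp [netBenefit_self]
      by_cases haw : G.Adj i w
      · rw [netBenefit_of_adj haw, netBenefit_of_adj (le_addLink G i j haw)]
      · refine netBenefit_mono hP (Ne.symm hwi) haw ?_ (edist_anti (le_addLink G i j)) ?_
        · rw [addLink_adj hij]
          rintro (h | ⟨-, h⟩ | ⟨h, -⟩)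
          · exact haw h
          · exact hwj h
          · exact hij h
        · exact fun h => h.mono (essential_anti (le_addLink G i j) i w)
  have h2 : ∑ y, ∑ z, bridging P G i y z ≤ ∑ y, ∑ z, bridging P (addLink G i j) i y z :=
    Finset.sum_le_sum fun y _ => Finset.sum_le_sum fun z _ => bridging_le_addLink hP hij y z
  rw [Finset.sum_add_distrib, Finset.sum_ite_eq' Finset.univ j, if_pos (Finset.mem_univ _)] at h1
  have := hP.cost_upper
  push_cast
  linarith

/-- If creating a missing link neither shortens the connections of `i` to third nodes nor saves
rents there, and increases the bridging benefits of `i` by at most `γ (2 b₂ - b₃)`, then it harms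
`i`, provided the other end is at distance `2`. -/
theorem utility_addLink_lt (hP : Admissible P) {G : SimpleGraph V} {i j : V}
    (hd : G.edist i j = 2)
    (hw : ∀ w, w ≠ i → w ≠ j → ¬ G.Adj i w → G.edist i w ≤ (addLink G i j).edist i w ∧
      ((essential G i w).Nonempty → (essential (addLink G i j) i w).Nonempty))
    (hbr : ∑ y, ∑ z, bridging P (addLink G i j) i y z ≤
      ∑ y, ∑ z, bridging P G i y z + P.γ * (2 * P.b 2 - P.b 3)) :
    utility P (addLink G i j) i < utility P G i := by
  classical
  have hij : i ≠ j := by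
    rintro rfl
    simp at hd
  have hadj : ¬ G.Adj i j := by
    intro h
    rw [edist_eq_one_iff_adj.2 h] at hd
    norm_num at hd
  rw [utility_eq, utility_eq, degree_addLink hij hadj]
  have h1 : ∑ w, (netBenefit P (addLink G i j) i w + if w = j then (1 - P.γ) * P.b 2 else 0) ≤
      ∑ w, netBenefit P G i w := by
    refine Finset.sum_le_sum fun w _ => ?_
    by_cases hwj : w = j
    · subst hwj
      rw [if_pos rfl, netBenefit_of_adj (addLink_adj_self hij), zero_add]
      simpa [hd, benefit_two] using le_netBenefit hP hij hadj
    · rw [if_neg hwj, add_zero]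
      by_cases hwi : w = i
      · subst hwi
        simp [netBenefit_self]
      by_cases haw : G.Adj i w
      · rw [netBenefit_of_adj haw, netBenefit_of_adj (le_addLink G i j haw)]
      · refine netBenefit_mono hP (Ne.symm hwi) ?_ haw (hw w hwi hwj haw).1 (hw w hwi hwj haw).2
        rw [addLink_adj hij]
        rintro (h | ⟨-, h⟩ | ⟨h, -⟩)
        · exact haw h
        · exact hwj h
        · exact hij h
  rw [Finset.sum_add_distrib, Finset.sum_ite_eq' Finset.univ j, if_pos (Finset.mem_univ _)] at h1
  have := hP.cost_lower
  push_cast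
  linarith

theorem bridging_comm (G : SimpleGraph V) (i y z : V) :
    bridging P G i y z = bridging P G i z y := by
  rw [bridging, bridging, essential_comm G y z, edist_comm]

theorem sum_bridging_eq_zero {G : SimpleGraph V} {i : V} (h : ∀ y z, i ∉ essential G y z) :
    ∑ y, ∑ z, bridging P G i y z = 0 := by
  simp [bridging, h]

theorem Admissible.b_two_pos (hP : Admissible P) : 0 < P.b 2 :=
  (hP.nonneg 3 (by norm_num)).trans_lt (hP.decay 2 (by norm_num))

theorem Admissible.bridging_gain_nonneg (hP : Admissible P) :
    0 ≤ P.γ * (2 * P.b 2 - P.b 3) :=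
  mul_nonneg hP.rent_nonneg (by
    have := hP.decay 2 (by norm_num)
    have := hP.b_two_pos
    norm_num at *
    linarith)

theorem sum_bridging_addLink_le_of_not_cut (hP : Admissible P) {G : SimpleGraph V} {i j : V}
    (hij : i ≠ j) (h : ∀ y z, i ∉ essential G y z) :
    ∑ y, ∑ z, bridging P (addLink G i j) i y z ≤
      ∑ y, ∑ z, bridging P G i y z + P.γ * (2 * P.b 2 - P.b 3) := by
  rw [sum_bridging_eq_zero h, sum_bridging_eq_zero fun y z => by
    rw [mem_essential_addLink hij]; exact h y z, zero_add]
  exact hP.bridging_gain_nonneg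

/-- Let `i` mediate only pairs containing a fixed node `u`. If the link `{i, j}` affects no such
pair but `{u, j}`, which has at most two mediators and distance at most `3` beforehand and
distance at least `2` afterwards, then it raises the bridging benefits of `i` by at most
`γ (2 b₂ - b₃)`. -/
theorem sum_bridging_addLink_le_of_cut (hP : Admissible P) {G : SimpleGraph V} {i j u : V}
    (hij : i ≠ j) (huj : u ≠ j) (h : ∀ y z, i ∈ essential G y z → y = u ∨ z = u)
    (hz : ∀ z, z ≠ j → i ∈ essential G u z → (essential G u z).card ≤ 1 ∧
      G.edist u z ≤ (addLink G i j).edist u z)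
    (hcard : (essential G u j).card ≤ 2) (hd : G.edist u j ≤ 3)
    (hd' : 2 ≤ (addLink G i j).edist u j) :
    ∑ y, ∑ z, bridging P (addLink G i j) i y z ≤
      ∑ y, ∑ z, bridging P G i y z + P.γ * (2 * P.b 2 - P.b 3) := by
  classical
  have hδ : 0 ≤ P.γ * (P.b 2 - P.b 3 / 2) := by
    have := hP.bridging_gain_nonneg
    linarith
  have key : ∀ z, bridging P (addLink G i j) i u z ≤
      bridging P G i u z + if z = j then P.γ * (P.b 2 - P.b 3 / 2) else 0 := by
    intro z
    by_cases hi : i ∈ essential G u z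
    swap
    · have hi' : i ∉ essential (addLink G i j) u z := by rwa [mem_essential_addLink hij]
      rw [bridging, bridging, if_neg hi, if_neg hi', zero_add]
      split_ifs
      · exact hδ
      · exact le_rfl
    have hi' : i ∈ essential (addLink G i j) u z := by rwa [mem_essential_addLink hij]
    have huz : u ≠ z := by
      rintro rfl
      simp [essential_self] at hi
    have hc : (1 : ℝ) ≤ (essential G u z).card := by
      exact_mod_cast Finset.card_pos.2 ⟨i, hi⟩
    have hc' : (1 : ℝ) ≤ (essential (addLink G i j) u z).card := by
      exact_mod_cast Finset.card_pos.2 ⟨i, hi'⟩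
    have hb' := benefit_nonneg hP (one_le_edist (G := addLink G i j) huz)
    have hb := benefit_nonneg hP (one_le_edist (G := G) huz)
    have hle : P.γ / ((essential (addLink G i j) u z).card : ℝ) *
        benefit P ((addLink G i j).edist u z) ≤ P.γ * benefit P ((addLink G i j).edist u z) :=
      mul_le_mul_of_nonneg_right (div_le_self hP.rent_nonneg hc') hb'
    rw [bridging, bridging, if_pos hi, if_pos hi']
    by_cases hzj : z = j
    · subst hzj
      rw [if_pos rfl]
      have h2 : benefit P ((addLink G i z).edist u z) ≤ P.b 2 := by
        simpa [benefit_two] using benefit_antitone hP (by norm_num) hd'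
      have h3 : P.b 3 ≤ benefit P (G.edist u z) := by
        simpa [benefit_three] using benefit_antitone hP (one_le_edist huz) hd
      have h4 : P.γ / 2 * P.b 3 ≤
          P.γ / ((essential G u z).card : ℝ) * benefit P (G.edist u z) := by
        refine mul_le_mul ?_ h3 (hP.nonneg 3 (by norm_num)) (by
          exact div_nonneg hP.rent_nonneg (Nat.cast_nonneg _))
        exact div_le_div_of_nonneg_left hP.rent_nonneg (by linarith) (by exact_mod_cast hcard)
      have h5 := mul_le_mul_of_nonneg_left h2 hP.rent_nonneg
      linarith
    · rw [if_neg hzj, add_zero]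
      obtain ⟨hz1, hz2⟩ := hz z hzj hi
      have hc1 : ((essential G u z).card : ℝ) = 1 := le_antisymm (by exact_mod_cast hz1) hc
      rw [hc1, div_one]
      exact hle.trans (mul_le_mul_of_nonneg_left (benefit_antitone hP (one_le_edist huz) hz2)
        hP.rent_nonneg)
  have hall : ∀ y z, bridging P (addLink G i j) i y z ≤ bridging P G i y z +
      ((if y = u then if z = j then P.γ * (P.b 2 - P.b 3 / 2) else 0 else 0) +
      (if z = u then if y = j then P.γ * (P.b 2 - P.b 3 / 2) else 0 else 0)) := by
    intro y z
    by_cases hy : y = u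
    · subst hy
      rw [if_pos rfl, if_neg huj]
      simpa using key z
    by_cases hzu : z = u
    · subst hzu
      rw [if_pos rfl, if_neg hy, zero_add, bridging_comm _ _ y, bridging_comm _ _ y]
      exact key y
    · have hi : i ∉ essential G y z := fun hi => (h y z hi).elim hy hzu
      have hi' : i ∉ essential (addLink G i j) y z := by rwa [mem_essential_addLink hij]
      simp [bridging, hi, hi', hy, hzu]
  refine (Finset.sum_le_sum fun y _ => Finset.sum_le_sum fun z _ => hall y z).trans ?_
  simp only [Finset.sum_add_distrib]
  simp
  linarith

end Utility

/-! ### The networks met while an entrant attaches itself -/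

section Stage

variable {V : Type*} {P : NetParams}

/-- The complete bipartite network with the colour classes of `side`, except that the node `v` is
linked only to those nodes of the opposite class that lie in `S`. -/
def stage (side : V → Bool) (v : V) (S : Finset V) : SimpleGraph V where
  Adj a b := side a ≠ side b ∧ (a = v → b ∈ S) ∧ (b = v → a ∈ S)
  symm := ⟨fun _ _ h => ⟨h.1.symm, h.2.2, h.2.1⟩⟩
  loopless := ⟨fun _ h => h.1 rfl⟩

/-- The situation after an entry: the entrant `v` has colour `false`, it is linked to some node of
colour `true`, and that class is at most as large as the class of `v`. -/
structure Attaching [Fintype V] (side : V → Bool) (v : V) (S : Finset V) : Prop where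
  side_entrant : side v = false
  exists_mem : ∃ t ∈ S, side t = true
  card_le : Fintype.card {a // side a = true} ≤ Fintype.card {a // side a = false}

variable {side : V → Bool} {v : V} {S : Finset V}

theorem ne_of_side {a b : V} (ha : side a = true) (hb : side b = false) : a ≠ b := by
  rintro rfl
  simp [ha] at hb

theorem stage_adj {a b : V} :
    (stage side v S).Adj a b ↔ side a ≠ side b ∧ (a = v → b ∈ S) ∧ (b = v → a ∈ S) := Iff.rfl

theorem stage_adj_of_ne {a b : V} (h : side a ≠ side b) (ha : a ≠ v) (hb : b ≠ v) :
    (stage side v S).Adj a b :=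
  ⟨h, fun h => absurd h ha, fun h => absurd h hb⟩

theorem stage_adj_entrant {s : V} (hv : side v = false) (hs : s ∈ S) (h : side s = true) :
    (stage side v S).Adj v s :=
  ⟨by simp [hv, h], fun _ => hs, fun h' => by simp [h', hv] at h⟩

/-- A node of colour `true` that belongs to `S` is linked to the whole opposite class. -/
theorem stage_adj_of_mem {s a : V} (hv : side v = false) (hs : s ∈ S) (h : side s = true)
    (ha : side a = false) : (stage side v S).Adj s a :=
  ⟨by simp [h, ha], fun h' => by simp [h', hv] at h, fun _ => hs⟩

theorem stage_side_ne {a b : V} (h : (stage side v S).Adj a b) : side a ≠ side b := h.1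

theorem not_stage_adj_entrant {x : V} (hx : x ∉ S) : ¬ (stage side v S).Adj v x :=
  fun h => hx (h.2.1 rfl)

theorem three_le_edist_stage {i j : V} (h : side i ≠ side j)
    (hadj : ¬ (stage side v S).Adj i j) : 3 ≤ (stage side v S).edist i j := by
  refine three_le_edist (fun hij => h (by rw [hij])) hadj fun w hw hw' => ?_
  have h1 := hw.1
  have h2 := hw'.1
  revert h h1 h2
  cases side i <;> cases side w <;> cases side j <;> simp

theorem addLink_stage [DecidableEq V] {x : V} (hv : side v = false) (hx : side x = true) :
    addLink (stage side v S) v x = stage side v (insert x S) := by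
  have hvx : v ≠ x := by
    rintro rfl
    simp [hv] at hx
  ext a b
  rw [addLink_adj hvx, stage_adj, stage_adj]
  constructor
  · rintro (⟨h1, h2, h3⟩ | ⟨rfl, rfl⟩ | ⟨rfl, rfl⟩)
    · exact ⟨h1, fun h => Finset.mem_insert_of_mem (h2 h), fun h => Finset.mem_insert_of_mem (h3 h)⟩
    · exact ⟨by simp [hv, hx], fun _ => Finset.mem_insert_self _ _, fun h => absurd h hvx.symm⟩
    · exact ⟨by simp [hv, hx], fun h => absurd h hvx.symm, fun _ => Finset.mem_insert_self _ _⟩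
  · rintro ⟨h1, h2, h3⟩
    by_cases ha : a = v
    · rcases Finset.mem_insert.1 (h2 ha) with h | h
      · exact Or.inr (Or.inl ⟨ha, h⟩)
      · refine Or.inl ⟨h1, fun _ => h, fun hb => ?_⟩
        exact absurd (congrArg side (ha.trans hb.symm)) h1
    by_cases hb : b = v
    · rcases Finset.mem_insert.1 (h3 hb) with h | h
      · exact Or.inr (Or.inr ⟨h, hb⟩)
      · exact Or.inl ⟨h1, fun h' => absurd h' ha, fun _ => h⟩
    · exact Or.inl ⟨h1, fun h' => absurd h' ha, fun h' => absurd h' hb⟩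

/-- No deletion pays in a bipartite network: two linked nodes have no common neighbour there,
so that they are at distance at least `3` afterwards. -/
theorem utility_deleteLink_lt [Fintype V] (hP : Admissible P) {G : SimpleGraph V}
    (hG : ∀ a b, G.Adj a b → side a ≠ side b) {i j : V} (h : G.Adj i j) :
    utility P (deleteLink G i j) i < utility P G i := by
  have hd : 3 ≤ (deleteLink G i j).edist i j := by
    refine three_le_edist h.ne ?_ fun w hw hw' => ?_
    · rw [deleteLink_adj]
      exact fun h' => h'.2 (Or.inl ⟨rfl, rfl⟩)
    · have h1 := hG _ _ (deleteLink_adj.1 hw).1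
      have h2 := hG _ _ (deleteLink_adj.1 hw').1
      have h3 := hG _ _ h
      revert h1 h2 h3
      cases side i <;> cases side w <;> cases side j <;> simp
  simpa [addLink_deleteLink h] using utility_lt_addLink_of_three_le hP hd

variable [Fintype V]

theorem Attaching.mono [DecidableEq V] (hA : Attaching side v S) (x : V) :
    Attaching side v (insert x S) :=
  ⟨hA.side_entrant, hA.exists_mem.imp fun _ h => ⟨Finset.mem_insert_of_mem h.1, h.2⟩, hA.card_le⟩

theorem Attaching.exists_false (hA : Attaching side v S) {x x' : V} (hx : side x = true)
    (hx' : side x' = true) (hne : x ≠ x') : ∃ y, y ≠ v ∧ side y = false := by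
  have h1 : 1 < Fintype.card {a // side a = true} :=
    Fintype.one_lt_card_iff.2 ⟨⟨x, hx⟩, ⟨x', hx'⟩, by simpa using hne⟩
  obtain ⟨⟨a, ha⟩, ⟨b, hb⟩, hab⟩ := Fintype.one_lt_card_iff.1 (h1.trans_le hA.card_le)
  by_cases hav : a = v
  · exact ⟨b, fun hbv => hab (by simp [hav, hbv]), hb⟩
  · exact ⟨a, hav, ha⟩

theorem Attaching.exists_two_false (hA : Attaching side v S) {x x' x'' : V} (hx : side x = true)
    (hx' : side x' = true) (hx'' : side x'' = true) (h₁ : x ≠ x') (h₂ : x ≠ x'') (h₃ : x' ≠ x'') :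
    ∃ y y', y ≠ y' ∧ y ≠ v ∧ y' ≠ v ∧ side y = false ∧ side y' = false := by
  have h1 : 2 < Fintype.card {a // side a = true} :=
    Fintype.two_lt_card_iff.2 ⟨⟨x, hx⟩, ⟨x', hx'⟩, ⟨x'', hx''⟩, by simpa using h₁,
      by simpa using h₂, by simpa using h₃⟩
  obtain ⟨⟨a, ha⟩, ⟨b, hb⟩, ⟨c, hc⟩, hab, hac, hbc⟩ :=
    Fintype.two_lt_card_iff.1 (h1.trans_le hA.card_le)
  simp only [ne_eq, Subtype.mk.injEq] at hab hac hbc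
  by_cases hav : a = v
  · exact ⟨b, c, hbc, fun h => hab (hav.trans h.symm), fun h => hac (hav.trans h.symm), hb, hc⟩
  by_cases hbv : b = v
  · exact ⟨a, c, hac, hav, fun h => hbc (hbv.trans h.symm), ha, hc⟩
  · exact ⟨a, b, hab, hav, hbv, ha, hb⟩

theorem Attaching.edist_eq_two (hA : Attaching side v S) {i j : V} (hij : i ≠ j)
    (h : side i = side j) : (stage side v S).edist i j = 2 := by
  have hadj : ¬ (stage side v S).Adj i j := fun h' => h'.1 h
  refine edist_eq_two_iff.2 ⟨hij, hadj, ?_⟩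
  cases hi : side i
  · obtain ⟨t, htS, ht⟩ := hA.exists_mem
    exact ⟨t, (stage_adj_of_mem hA.side_entrant htS ht hi).symm,
      (stage_adj_of_mem hA.side_entrant htS ht (h ▸ hi)).symm⟩
  · obtain ⟨y, hyv, hy⟩ := hA.exists_false hi (h ▸ hi) hij
    have hj : side j = true := h ▸ hi
    exact ⟨y, stage_adj_of_ne (by simp [hi, hy]) (ne_of_side hi hA.side_entrant) hyv,
      stage_adj_of_ne (by simp [hj, hy]) (ne_of_side hj hA.side_entrant) hyv⟩

/-- A link between two nodes `i`, `j` of the same colour neither shortens the connections of `i` to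
third nodes nor saves rents there, unless `i` gains a shortcut to the entrant. -/
theorem Attaching.connections_addLink (hA : Attaching side v S) {i j : V} (hij : i ≠ j)
    (hside : side i = side j) (hiv : i ≠ v) (hS : j ∈ S → side i = true → i ∈ S) {w : V}
    (hwi : w ≠ i) (hwj : w ≠ j) (hw : ¬ (stage side v S).Adj i w) :
    (stage side v S).edist i w ≤ (addLink (stage side v S) i j).edist i w ∧
      ((essential (stage side v S) i w).Nonempty →
        (essential (addLink (stage side v S) i j) i w).Nonempty) := by
  have hv := hA.side_entrant
  obtain ⟨t, htS, ht⟩ := hA.exists_mem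
  have hw' : ¬ (addLink (stage side v S) i j).Adj i w := by
    rw [addLink_adj hij]
    rintro (h | ⟨-, h⟩ | ⟨h, -⟩)
    · exact hw h
    · exact hwj h
    · exact hij h
  -- The neighbours of `w` are the same before and after.
  have hnbr : ∀ x, (addLink (stage side v S) i j).Adj w x → (stage side v S).Adj w x := by
    intro x hx
    rcases (addLink_adj hij).1 hx with h | ⟨h, -⟩ | ⟨h, -⟩
    · exact h
    · exact absurd h hwi
    · exact absurd h hwj
  by_cases hsw : side i = side w
  · refine ⟨?_, ?_⟩
    · rw [hA.edist_eq_two hwi.symm hsw]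
      exact two_le_edist hwi.symm hw'
    rintro ⟨a, ha⟩
    cases hi : side i
    · have hw0 : side w = false := hsw ▸ hi
      have hat := eq_of_mem_essential_two (stage_adj_of_mem hv htS ht hi).symm
        (stage_adj_of_mem hv htS ht hw0) ha
      refine ⟨t, mem_essential_of_pendant hwi.symm (ne_of_side ht hi).symm
        (ne_of_side ht hw0).symm fun x hx => ?_⟩
      have hx' := hnbr x hx
      have hx1 : side x = true := by
        have := hx'.1
        simpa [hw0] using this.symm
      have hax := eq_of_mem_essential_two (stage_adj_of_ne (by simp [hi, hx1]) hiv
        (ne_of_side hx1 hv)) hx'.symm ha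
      rw [← hax, hat]
    · have hw1 : side w = true := hsw ▸ hi
      obtain ⟨y, y', hyy, hyv, hyv', hy, hy'⟩ := hA.exists_two_false hi (hside ▸ hi) hw1 hij
        hwi.symm hwj.symm
      have hwv := ne_of_side hw1 hv
      have h1 := eq_of_mem_essential_two (stage_adj_of_ne (by simp [hi, hy]) hiv hyv)
        (stage_adj_of_ne (S := S) (by simp [hw1, hy]) hyv hwv) ha
      have h2 := eq_of_mem_essential_two (stage_adj_of_ne (by simp [hi, hy']) hiv hyv')
        (stage_adj_of_ne (S := S) (by simp [hw1, hy']) hyv' hwv) ha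
      exact absurd (h1.symm.trans h2) hyy
  · -- The only missing links between the classes are those of the entrant.
    have hwv : w = v := by
      by_contra h
      exact hw (stage_adj_of_ne hsw hiv h)
    subst hwv
    have hi : side i = true := by simpa [hv] using hsw
    have hj : side j = true := hside ▸ hi
    have hiS : i ∉ S := fun h => hw (stage_adj_entrant hv h hi).symm
    have hjS : j ∉ S := fun h => hiS (hS h hi)
    have hit : i ≠ t := fun h => hiS (h ▸ htS)
    have hjt : j ≠ t := fun h => hjS (h ▸ htS)
    obtain ⟨y, y', hyy, hyv, hyv', hy, hy'⟩ := hA.exists_two_false hi hj ht hij hit hjt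
    have hpath : ∀ z x, z ≠ w → side z = false → x ∈ S → side x = true →
        (stage side w S).Adj i z ∧ (stage side w S).Adj z x ∧ (stage side w S).Adj x w :=
      fun z x hzw hz hxS hx => ⟨stage_adj_of_ne (by simp [hi, hz]) hiv hzw,
        (stage_adj_of_mem hv hxS hx hz).symm, (stage_adj_entrant hv hxS hx).symm⟩
    refine ⟨?_, ?_⟩
    · obtain ⟨h1, h2, h3⟩ := hpath y t hyv hy htS ht
      refine (edist_le_three h1 h2 h3).trans (three_le_edist hiv hw' fun x hx hxw => ?_)
      have hx1 := hnbr x hxw.symm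
      have hxS : x ∈ S := hx1.2.1 rfl
      have hxt : side x = true := by
        have := hx1.1
        simpa [hv] using this.symm
      rcases (addLink_adj hij).1 hx with h | ⟨-, h⟩ | ⟨h, -⟩
      · exact h.1 (by rw [hi, hxt])
      · exact hjS (h ▸ hxS)
      · exact hij h
    · rintro ⟨a, ha⟩
      have hkey : ∀ x, x ∈ S → side x = true → a = x := by
        intro x hxS hx
        obtain ⟨h1, h2, h3⟩ := hpath y x hyv hy hxS hx
        obtain ⟨h1', h2', h3'⟩ := hpath y' x hyv' hy' hxS hx
        rcases eq_of_mem_essential_three h1 h2 h3 ha with h | h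
        · rcases eq_of_mem_essential_three h1' h2' h3' ha with h' | h'
          · exact absurd (h.symm.trans h') hyy
          · exact h'
        · exact h
      refine ⟨t, mem_essential_of_pendant hiv hit (ne_of_side ht hv).symm fun x hx => ?_⟩
      have hx1 := hnbr x hx
      have hxt : side x = true := by
        have := hx1.1
        simpa [hv] using this.symm
      rw [← hkey x (hx1.2.1 rfl) hxt, ← hkey t htS ht]

/-- The bridging benefits of a node other than the entrant increase by at most `γ (2 b₂ - b₃)`
when it links to a node of its own colour. A node `i` of colour `true` mediates at most the
connections of the entrant, if it is the only neighbour of the entrant; a node of colour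
`false` mediates only if the network is a path on four nodes. -/
theorem Attaching.sum_bridging_addLink_le (hP : Admissible P) (hA : Attaching side v S) {i j : V}
    (hij : i ≠ j) (hside : side i = side j) (hiv : i ≠ v) :
    ∑ y, ∑ z, bridging P (addLink (stage side v S) i j) i y z ≤
      ∑ y, ∑ z, bridging P (stage side v S) i y z + P.γ * (2 * P.b 2 - P.b 3) := by
  classical
  have hv := hA.side_entrant
  obtain ⟨t, htS, ht⟩ := hA.exists_mem
  have htv := ne_of_side ht hv
  cases hi : side i
  · by_cases hQ : ∃ y₀, y₀ ≠ i ∧ y₀ ≠ v ∧ side y₀ = false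
    · obtain ⟨y₀, hy₀i, hy₀v, hy₀⟩ := hQ
      have hti := ne_of_side ht hi
      have hty := stage_adj_of_mem hv htS ht hy₀
      refine sum_bridging_addLink_le_of_not_cut hP hij (not_mem_essential_of_hub (o := y₀) ?_)
      intro y hy
      cases hsy : side y
      · exact (JoinedAvoiding.of_adj hy hti (stage_adj_of_mem hv htS ht hsy).symm).trans
          (JoinedAvoiding.of_adj hti hy₀i hty)
      · exact JoinedAvoiding.of_adj hy hy₀i (stage_adj_of_ne (by simp [hsy, hy₀])
          (ne_of_side hsy hv) hy₀v)
    push Not at hQ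
    have hQ' : ∀ y, side y = false → y = i ∨ y = v := by
      intro y hy
      by_contra! hc
      exact absurd hy (hQ y hc.1 hc.2)
    have hjv : j = v := (hQ' j (hside ▸ hi)).resolve_left hij.symm
    subst hjv
    by_cases hPS : ∃ x, side x = true ∧ x ∉ S
    · obtain ⟨x, hx, hxS⟩ := hPS
      have hxt : x ≠ t := fun h => hxS (h ▸ htS)
      have hxj := ne_of_side hx hv
      have htrue : ∀ z, side z = true → z = x ∨ z = t := by
        intro z hz
        by_contra! hc
        obtain ⟨y, y', hyy, hyv, hyv', hy, hy'⟩ := hA.exists_two_false hx ht hz hxt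
          hc.1.symm hc.2.symm
        exact hyy (((hQ' y hy).resolve_right hyv).trans ((hQ' y' hy').resolve_right hyv').symm)
      have hxi : (stage side j S).Adj x i := stage_adj_of_ne (by simp [hx, hi]) hxj hiv
      have hit : (stage side j S).Adj i t := stage_adj_of_ne (by simp [ht, hi]) hiv htv
      have htj : (stage side j S).Adj t j := (stage_adj_entrant hv htS ht).symm
      refine sum_bridging_addLink_le_of_cut (u := x) hP hij hxj ?_ ?_ ?_ ?_ ?_
      · refine fun y z => eq_or_eq_of_mem_essential (o := t) fun y hyi hyx => ?_
        have hti := ne_of_side ht hi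
        cases hsy : side y
        · obtain rfl := (hQ' y hsy).resolve_left hyi
          exact JoinedAvoiding.of_adj hyi hti htj.symm
        · obtain rfl := (htrue y hsy).resolve_left hyx
          exact JoinedAvoiding.refl hyi
      · intro z hzj hz
        obtain ⟨-, hiz, -⟩ := mem_essential.1 hz
        have hzt : z = t := by
          cases hsz : side z
          · exact absurd ((hQ' z hsz).resolve_right hzj) hiz.symm
          · refine (htrue z hsz).resolve_left fun hzx => ?_
            subst hzx
            simp [essential_self] at hz
        subst hzt
        refine ⟨?_, ?_⟩
        · rw [Finset.card_le_one]
          intro a ha b hb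
          rw [eq_of_mem_essential_two hxi hit ha, eq_of_mem_essential_two hxi hit hb]
        · refine (edist_le_two hxi hit).trans (two_le_edist hxt fun h => ?_)
          rcases (addLink_adj hij).1 h with h | ⟨h, -⟩ | ⟨h, -⟩
          · exact h.1 (by rw [hx, ht])
          · exact ne_of_side hx hi h
          · exact hxj h
      · calc (essential (stage side j S) x j).card ≤ ({i, t} : Finset V).card := by
              refine Finset.card_le_card fun a ha => ?_
              simpa using eq_of_mem_essential_three hxi hit htj ha
          _ ≤ 2 := Finset.card_le_two
      · exact edist_le_three hxi hit htj
      · refine two_le_edist hxj fun h => ?_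
        rcases (addLink_adj hij).1 h with h | ⟨h, -⟩ | ⟨h, -⟩
        · exact hxS (h.2.2 rfl)
        · exact ne_of_side hx hi h
        · exact hxj h
    · push Not at hPS
      refine sum_bridging_addLink_le_of_not_cut hP hij (not_mem_essential_of_hub (o := j) ?_)
      intro y hy
      cases hsy : side y
      · obtain rfl := (hQ' y hsy).resolve_left hy
        exact JoinedAvoiding.refl hy
      · exact JoinedAvoiding.of_adj hy hij.symm (stage_adj_entrant hv (hPS y hsy) hsy).symm
  · have hj : side j = true := hside ▸ hi
    have hjv := ne_of_side hj hv
    obtain ⟨y₀, hy₀v, hy₀⟩ := hA.exists_false hi hj hij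
    have hy₀i := (ne_of_side hi hy₀).symm
    have hbase : ∀ y, y ≠ i → y ≠ v → JoinedAvoiding (stage side v S) i y y₀ := by
      intro y hyi hyv
      cases hsy : side y
      · exact (JoinedAvoiding.of_adj hyi hij.symm (stage_adj_of_ne (by simp [hsy, hj]) hyv
          hjv)).trans
          (JoinedAvoiding.of_adj hij.symm hy₀i (stage_adj_of_ne (by simp [hj, hy₀]) hjv hy₀v))
      · exact JoinedAvoiding.of_adj hyi hy₀i (stage_adj_of_ne (by simp [hsy, hy₀]) hyv hy₀v)
    by_cases hx : ∃ x ∈ S, side x = true ∧ x ≠ i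
    · obtain ⟨x, hxS, hx, hxi⟩ := hx
      refine sum_bridging_addLink_le_of_not_cut hP hij (not_mem_essential_of_hub (o := y₀) ?_)
      intro y hyi
      by_cases hyv : y = v
      · subst hyv
        exact (JoinedAvoiding.of_adj hyi hxi (stage_adj_entrant hv hxS hx)).trans
          (hbase x hxi (ne_of_side hx hv))
      · exact hbase y hyi hyv
    push Not at hx
    have hti := hx t htS ht
    subst hti
    have hvt := stage_adj_entrant hv htS ht
    -- The entrant's only neighbour is `t`, before and after.
    have hnbr : ∀ x, (addLink (stage side v S) t j).Adj v x → x = t := by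
      intro x h
      rcases (addLink_adj hij).1 h with h | ⟨h, -⟩ | ⟨h, -⟩
      · exact hx x (h.2.1 rfl) (by
          have := h.1
          simpa [hv] using this.symm)
      · exact absurd h htv.symm
      · exact absurd h hjv.symm
    have hpath : ∀ y z, y ≠ v → side y = false → side z = true →
        (stage side v S).Adj t y ∧ (stage side v S).Adj y z := fun y z hyv hy hz =>
      ⟨stage_adj_of_ne (by simp [ht, hy]) htv hyv,
        stage_adj_of_ne (by simp [hz, hy]) hyv (ne_of_side hz hv)⟩
    refine sum_bridging_addLink_le_of_cut (u := v) hP hij hjv.symm ?_ ?_ ?_ ?_ ?_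
    · exact fun y z => eq_or_eq_of_mem_essential hbase
    · intro z hzj hz
      obtain ⟨-, htz, -⟩ := mem_essential.1 hz
      have hzv : v ≠ z := by
        rintro rfl
        simp [essential_self] at hz
      have hvz : ¬ (addLink (stage side v S) t j).Adj v z := fun h => htz (hnbr z h).symm
      cases hsz : side z
      · have htz' := stage_adj_of_mem hv htS ht hsz
        refine ⟨?_, (edist_le_two hvt htz').trans (two_le_edist hzv hvz)⟩
        rw [Finset.card_le_one]
        intro a ha b hb
        rw [eq_of_mem_essential_two hvt htz' ha, eq_of_mem_essential_two hvt htz' hb]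
      · obtain ⟨y, y', hyy, hyv, hyv', hy, hy'⟩ := hA.exists_two_false ht hj hsz hij
          htz hzj.symm
        obtain ⟨h1, h2⟩ := hpath y z hyv hy hsz
        obtain ⟨h1', h2'⟩ := hpath y' z hyv' hy' hsz
        refine ⟨?_, (edist_le_three hvt h1 h2).trans (three_le_edist hzv hvz ?_)⟩
        · have hone : ∀ a ∈ essential (stage side v S) v z, a = t := by
            intro a ha
            rcases eq_of_mem_essential_three hvt h1 h2 ha with h | h
            · exact h
            · rcases eq_of_mem_essential_three hvt h1' h2' ha with h' | h'
              · exact h'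
              · exact absurd (h.symm.trans h') hyy
          rw [Finset.card_le_one]
          intro a ha b hb
          rw [hone a ha, hone b hb]
        · intro x hvx hxz
          rw [hnbr x hvx] at hxz
          rcases (addLink_adj hij).1 hxz with h | ⟨-, h⟩ | ⟨h, -⟩
          · exact h.1 (by rw [ht, hsz])
          · exact hzj h
          · exact hij h
    · obtain ⟨h1, h2⟩ := hpath y₀ j hy₀v hy₀ hj
      calc (essential (stage side v S) v j).card ≤ ({t, y₀} : Finset V).card := by
            refine Finset.card_le_card fun a ha => ?_
            simpa using eq_of_mem_essential_three hvt h1 h2 ha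
        _ ≤ 2 := Finset.card_le_two
    · obtain ⟨h1, h2⟩ := hpath y₀ j hy₀v hy₀ hj
      exact edist_le_three hvt h1 h2
    · exact two_le_edist hjv.symm fun h => hij (hnbr j h).symm

/-- A link within a colour class harms one of its ends: the one other than the entrant, and in the
opposite class one that gets no closer to the entrant. -/
theorem Attaching.utility_addLink_lt_or (hP : Admissible P) (hA : Attaching side v S) {i j : V}
    (hij : i ≠ j) (hside : side i = side j) :
    utility P (addLink (stage side v S) i j) i < utility P (stage side v S) i ∨
      utility P (addLink (stage side v S) i j) j < utility P (stage side v S) j := by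
  have key : ∀ i j, i ≠ j → side i = side j → i ≠ v → (j ∈ S → side i = true → i ∈ S) →
      utility P (addLink (stage side v S) i j) i < utility P (stage side v S) i :=
    fun i j hij hside hiv hS => utility_addLink_lt hP (hA.edist_eq_two hij hside)
      (fun w hwi hwj hw => hA.connections_addLink hij hside hiv hS hwi hwj hw)
      (hA.sum_bridging_addLink_le hP hij hside hiv)
  have key' : j ≠ v → (i ∈ S → side j = true → j ∈ S) →
      utility P (addLink (stage side v S) i j) j < utility P (stage side v S) j := by
    rw [addLink_comm]
    exact key j i hij.symm hside.symm
  cases hi : side i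
  · have hj : side j = false := hside ▸ hi
    by_cases hiv : i = v
    · exact Or.inr (key' (fun h => hij (hiv.trans h.symm)) (by simp [hj]))
    · exact Or.inl (key i j hij hside hiv (by simp [hi]))
  · have hj : side j = true := hside ▸ hi
    by_cases h : j ∈ S → i ∈ S
    · exact Or.inl (key i j hij hside (ne_of_side hi hA.side_entrant) fun hjS _ => h hjS)
    · push Not at h
      exact Or.inr (key' (ne_of_side hj hA.side_entrant) fun _ _ => h.1)

end Stage

/-! ### The evolution after an entry -/

section Evolution

variable {V : Type*} [Fintype V] {P : NetParams} {side : V → Bool} {v : V} {S : Finset V}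

theorem exists_bestResponse (P : NetParams) (G : SimpleGraph V) (i : V) :
    ∃ H, BestResponse P G i H := by
  obtain ⟨H, hH, hmax⟩ := Set.exists_max_image {H | MoveOption P G i H} (fun H => utility P H i)
    (Set.toFinite _) ⟨G, MoveOption.stay⟩
  by_cases h : utility P H i ≤ utility P G i
  · exact ⟨G, MoveOption.stay, fun H' hH' => (hmax H' hH').trans h, fun _ => rfl⟩
  · exact ⟨H, hH, hmax, fun h' => absurd h' h⟩

/-- A missing link between the colour classes benefits both of its ends. -/
theorem utility_lt_addLink_stage (hP : Admissible P) {i j : V} (h : side i ≠ side j)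
    (hadj : ¬ (stage side v S).Adj i j) :
    utility P (stage side v S) i < utility P (addLink (stage side v S) i j) i ∧
      utility P (stage side v S) j < utility P (addLink (stage side v S) i j) j := by
  refine ⟨utility_lt_addLink_of_three_le hP (three_le_edist_stage h hadj), ?_⟩
  rw [addLink_comm]
  exact utility_lt_addLink_of_three_le hP (three_le_edist_stage h.symm fun h' => hadj h'.symm)

/-- While the entrant is attaching itself, a best response either changes nothing or links the
entrant to a further node of the opposite class. The entrant itself does not rest before it is
linked to the whole class. -/
theorem Attaching.bestResponse [DecidableEq V] (hP : Admissible P) (hA : Attaching side v S)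
    {i : V} {H : SimpleGraph V} (hH : BestResponse P (stage side v S) i H) :
    (H = stage side v S ∧ (i = v → ∀ x, side x = true → x ∈ S)) ∨
      ∃ x, side x = true ∧ x ∉ S ∧ H = stage side v (insert x S) := by
  have hv := hA.side_entrant
  obtain ⟨hmove, hmax, -⟩ := hH
  cases hmove with
  | stay =>
    refine Or.inl ⟨rfl, ?_⟩
    rintro rfl x hx
    by_contra hxS
    obtain ⟨h1, h2⟩ := utility_lt_addLink_stage (side := side) hP (v := i) (i := i) (j := x)
      (by simp [hv, hx])
      (not_stage_adj_entrant hxS)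
    exact (hmax _ (MoveOption.create x (ne_of_side hx hv).symm (not_stage_adj_entrant hxS)
      h2.le)).not_gt h1
  | create j hij hadj hacc =>
    by_cases hside : side i = side j
    · rcases hA.utility_addLink_lt_or hP hij hside with h | h
      · exact absurd (hmax _ MoveOption.stay) h.not_ge
      · exact absurd hacc h.not_ge
    · refine Or.inr ?_
      by_cases hiv : i = v
      · subst hiv
        have hj : side j = true := by simpa [hv] using Ne.symm hside
        exact ⟨j, hj, fun h => hadj (stage_adj_entrant hv h hj), addLink_stage hv hj⟩
      by_cases hjv : j = v
      · subst hjv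
        have hi : side i = true := by simpa [hv] using hside
        exact ⟨i, hi, fun h => hadj (stage_adj_entrant hv h hi).symm, by
          rw [addLink_comm, addLink_stage hv hi]⟩
      · exact absurd (stage_adj_of_ne hside hiv hjv) hadj
  | delete j hadj =>
    exact absurd (hmax _ MoveOption.stay)
      (utility_deleteLink_lt hP (fun _ _ => stage_side_ne) hadj).not_ge

theorem Attaching.pairwiseStable (hP : Admissible P) (hA : Attaching side v S)
    (hS : ∀ x, side x = true → x ∈ S) : PairwiseStable P (stage side v S) := by
  have hv := hA.side_entrant
  refine ⟨fun i j h => (utility_deleteLink_lt hP (fun _ _ => stage_side_ne) h).le,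
    fun i j hij hadj hgain => ?_⟩
  by_cases hside : side i = side j
  · exact (hA.utility_addLink_lt_or hP hij hside).resolve_left hgain.not_gt
  · refine absurd ⟨hside, ?_, ?_⟩ hadj
    · rintro rfl
      exact hS _ (by simpa [hv] using Ne.symm hside)
    · rintro rfl
      exact hS _ (by simpa [hv] using hside)

theorem Attaching.mem_of_pairwiseStable (hP : Admissible P) (hA : Attaching side v S)
    (hstable : PairwiseStable P (stage side v S)) {x : V} (hx : side x = true) : x ∈ S := by
  by_contra hxS
  have hv := hA.side_entrant
  obtain ⟨h1, h2⟩ := utility_lt_addLink_stage (side := side) hP (v := v) (i := v) (j := x)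
    (by simp [hv, hx])
    (not_stage_adj_entrant hxS)
  exact (hstable.2 v x (ne_of_side hx hv).symm (not_stage_adj_entrant hxS) h1).not_gt h2

/-- Along the evolution the network stays of the same form. -/
theorem Attaching.reflTransGen [DecidableEq V] (hP : Admissible P) (hA : Attaching side v S)
    {H : SimpleGraph V}
    (h : Relation.ReflTransGen (fun A B => ∃ i, BestResponse P A i B) (stage side v S) H) :
    ∃ T, Attaching side v T ∧ H = stage side v T := by
  induction h with
  | refl => exact ⟨S, hA, rfl⟩
  | tail _ hstep ih =>
    obtain ⟨T, hT, rfl⟩ := ih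
    obtain ⟨i, hi⟩ := hstep
    rcases hT.bestResponse hP hi with ⟨h, -⟩ | ⟨x, -, -, h⟩
    · exact ⟨T, hT, h⟩
    · exact ⟨insert x T, hT.mono x, h⟩

theorem card_missing_insert_lt [DecidableEq V] {x : V} (hx : side x = true) (hxS : x ∉ S) :
    (Finset.univ.filter fun a => side a = true ∧ a ∉ insert x S).card <
      (Finset.univ.filter fun a => side a = true ∧ a ∉ S).card := by
  refine Finset.card_lt_card (Finset.ssubset_iff_of_subset ?_ |>.2 ⟨x, by simp [hx, hxS]⟩)
  intro a
  simp only [Finset.mem_filter, Finset.mem_univ, true_and, Finset.mem_insert, not_or]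
  exact fun h => ⟨h.1, h.2.2⟩

/-- If only the entrant moves, it ends up linked to the whole opposite class. -/
theorem Attaching.exists_reflTransGen [DecidableEq V] (hP : Admissible P)
    (hA : Attaching side v S) :
    ∃ T, Attaching side v T ∧ (∀ x, side x = true → x ∈ T) ∧
      Relation.ReflTransGen (fun A B => ∃ i, BestResponse P A i B) (stage side v S)
        (stage side v T) := by
  induction hN : (Finset.univ.filter fun a => side a = true ∧ a ∉ S).card using
    Nat.strong_induction_on generalizing S with
  | _ N ih =>
    obtain ⟨H, hH⟩ := exists_bestResponse P (stage side v S) v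
    rcases hA.bestResponse hP hH with ⟨-, h⟩ | ⟨x, hx, hxS, rfl⟩
    · exact ⟨S, hA, h rfl, Relation.ReflTransGen.refl⟩
    · obtain ⟨T, hT, hfull, hreach⟩ :=
        ih _ (hN ▸ card_missing_insert_lt hx hxS) (hA.mono x) rfl
      exact ⟨T, hT, hfull, Relation.ReflTransGen.head ⟨v, hH⟩ hreach⟩

/-- Every fair evolution reaches the network in which the entrant is linked to the whole opposite
class, and stays there: each time the entrant moves before that, the set of its neighbours has
grown or grows. -/
theorem Attaching.exists_eventually_eq [DecidableEq V] (hP : Admissible P)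
    (hA : Attaching side v S) {m : ℕ → V} {g : ℕ → SimpleGraph V} (hm : FairSchedule m)
    (hg : ∀ k, BestResponse P (g k) (m k) (g (k + 1))) {k₀ : ℕ} (hk₀ : g k₀ = stage side v S) :
    ∃ T U, Attaching side v T ∧ (∀ x, side x = true → x ∈ T) ∧
      ∀ k, U ≤ k → g k = stage side v T := by
  induction hN : (Finset.univ.filter fun a => side a = true ∧ a ∉ S).card using
    Nat.strong_induction_on generalizing S k₀ with
  | _ N ih =>
    by_cases hfull : ∀ x, side x = true → x ∈ S
    · refine ⟨S, k₀, hA, hfull, fun k hk => ?_⟩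
      induction k, hk using Nat.le_induction with
      | base => exact hk₀
      | succ k hk ihk =>
        rcases hA.bestResponse hP (ihk ▸ hg k) with ⟨h, -⟩ | ⟨x, hx, hxS, -⟩
        · exact h
        · exact absurd (hfull x hx) hxS
    · have hstep : ∀ k, k₀ ≤ k → g k = stage side v S ∨
          ∃ k' x, side x = true ∧ x ∉ S ∧ g k' = stage side v (insert x S) := by
        intro k hk
        induction k, hk using Nat.le_induction with
        | base => exact Or.inl hk₀
        | succ k hk ihk =>
          rcases ihk with h | h
          · rcases hA.bestResponse hP (h ▸ hg k) with ⟨h', -⟩ | ⟨x, hx, hxS, h'⟩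
            · exact Or.inl h'
            · exact Or.inr ⟨k + 1, x, hx, hxS, h'⟩
          · exact Or.inr h
      have hgrow : ∃ k' x, side x = true ∧ x ∉ S ∧ g k' = stage side v (insert x S) := by
        obtain ⟨k, hk, hkv⟩ := hm v k₀
        rcases hstep k hk with h | h
        · rcases hA.bestResponse hP (h ▸ hg k) with ⟨-, h'⟩ | ⟨x, hx, hxS, h'⟩
          · exact absurd (h' hkv) hfull
          · exact ⟨k + 1, x, hx, hxS, h'⟩
        · exact h
      obtain ⟨k', x, hx, hxS, h⟩ := hgrow
      exact ih _ (hN ▸ card_missing_insert_lt hx hxS) (hA.mono x) h rfl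

end Evolution

/-! ### Balanced complete bipartite networks -/

section Balanced

/-- `G` is complete bipartite with the colour classes of `side`, whose sizes differ by at most
one. -/
structure IsBalanced {V : Type*} [Fintype V] (G : SimpleGraph V) (side : V → Bool) : Prop where
  adj_iff : ∀ a b, G.Adj a b ↔ side a ≠ side b
  card_true_le : Fintype.card {a // side a = true} ≤ Fintype.card {a // side a = false} + 1
  card_false_le : Fintype.card {a // side a = false} ≤ Fintype.card {a // side a = true} + 1

theorem card_true_add_card_false {V : Type*} [Fintype V] (side : V → Bool) :
    Fintype.card {a // side a = true} + Fintype.card {a // side a = false} = Fintype.card V := by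
  rw [Fintype.card_subtype, Fintype.card_subtype, ← Finset.card_univ,
    ← Finset.card_filter_add_card_filter_not (s := Finset.univ) (fun a => side a = true)]
  simp

theorem IsBalanced.swap {V : Type*} [Fintype V] {G : SimpleGraph V} {side : V → Bool}
    (h : IsBalanced G side) : IsBalanced G (fun a => !side a) :=
  ⟨fun a b => by simp [h.adj_iff], by simpa using h.card_false_le, by simpa using h.card_true_le⟩

theorem nonempty_iso_of_card_eq {V W : Type*} [Fintype V] [Fintype W] {G : SimpleGraph V}
    {H : SimpleGraph W} {c : V → Bool} {d : W → Bool} (hG : ∀ a b, G.Adj a b ↔ c a ≠ c b)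
    (hH : ∀ a b, H.Adj a b ↔ d a ≠ d b)
    (h : ∀ k, Fintype.card {a // c a = k} = Fintype.card {a // d a = k}) : Nonempty (G ≃g H) := by
  let e := Equiv.ofFiberEquiv (f := c) (g := d) fun k => Fintype.equivOfCardEq (h k)
  have he : ∀ a, d (e a) = c a := fun a => Equiv.ofFiberEquiv_map _ a
  exact ⟨⟨e, by intro a b; simp [hG, hH, he]⟩⟩

theorem isBalanced_turanGraph (n : ℕ) :
    IsBalanced (turanGraph n 2) (fun a : Fin n => decide ((a : ℕ) % 2 = 0)) ∧
      Fintype.card {a : Fin n // decide ((a : ℕ) % 2 = 0) = false} ≤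
        Fintype.card {a : Fin n // decide ((a : ℕ) % 2 = 0) = true} := by
  have hcount : ∀ r, r < 2 → Fintype.card {a : Fin n // (a : ℕ) % 2 = r} =
      n / 2 + if r < n % 2 then 1 else 0 := by
    intro r hr
    have h := Nat.count_modEq_card n (r := 2) (by norm_num) r
    rw [Nat.mod_eq_of_lt hr] at h
    rw [← h, Nat.count_eq_card_filter_range, Fintype.card_subtype]
    refine Finset.card_bij (fun a _ => (a : ℕ)) ?_ ?_ ?_
    · intro a ha
      simpa [Nat.ModEq, Nat.mod_eq_of_lt hr] using ha
    · exact fun a _ b _ h => Fin.ext h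
    · intro b hb
      simp only [Finset.mem_filter, Finset.mem_range, Nat.ModEq, Nat.mod_eq_of_lt hr] at hb
      exact ⟨⟨b, hb.1⟩, by simpa using hb.2, rfl⟩
  have h0 := hcount 0 (by norm_num)
  have h1 := hcount 1 (by norm_num)
  have h0' : Fintype.card {a : Fin n // decide ((a : ℕ) % 2 = 0) = true} =
      n / 2 + if 0 < n % 2 then 1 else 0 := by
    rw [← h0]
    exact Fintype.card_congr (Equiv.subtypeEquivRight fun a => by simp)
  have h1' : Fintype.card {a : Fin n // decide ((a : ℕ) % 2 = 0) = false} =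
      n / 2 + if 1 < n % 2 then 1 else 0 := by
    rw [← h1]
    exact Fintype.card_congr (Equiv.subtypeEquivRight fun a => by simp)
  refine ⟨⟨fun a b => ?_, ?_, ?_⟩, ?_⟩
  · rw [turanGraph_adj]
    rcases Nat.mod_two_eq_zero_or_one a with ha | ha <;>
      rcases Nat.mod_two_eq_zero_or_one b with hb | hb <;> simp [ha, hb]
  all_goals
    rw [h0', h1']
    split_ifs <;> omega

theorem IsBalanced.nonempty_iso_turanGraph {n : ℕ} {G : SimpleGraph (Fin n)}
    {side : Fin n → Bool} (h : IsBalanced G side) : Nonempty (G ≃g turanGraph n 2) := by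
  wlog hle : Fintype.card {a // side a = false} ≤ Fintype.card {a // side a = true}
    generalizing side
  · exact this h.swap (by simpa using (not_le.1 hle).le)
  obtain ⟨hT, hTle⟩ := isBalanced_turanGraph n
  have h1 := card_true_add_card_false side
  have h2 := card_true_add_card_false (fun a : Fin n => decide ((a : ℕ) % 2 = 0))
  have h3 := h.card_true_le
  have h4 := hT.card_true_le
  refine nonempty_iso_of_card_eq h.adj_iff hT.adj_iff fun k => ?_
  cases k <;> omega

theorem isBalanced_stage {V : Type*} [Fintype V] {side : V → Bool} {v : V} {S : Finset V}
    (hA : Attaching side v S) (hS : ∀ x, side x = true → x ∈ S)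
    (hcard : Fintype.card {a // side a = false} ≤ Fintype.card {a // side a = true} + 1) :
    IsBalanced (stage side v S) side := by
  have hv := hA.side_entrant
  refine ⟨fun a b => ⟨fun h => h.1, fun h => ⟨h, ?_, ?_⟩⟩, hA.card_le.trans (Nat.le_succ _), hcard⟩
  · rintro rfl
    exact hS _ (by simpa [hv] using Ne.symm h)
  · rintro rfl
    exact hS _ (by simpa [hv] using h)

end Balanced

/-! ### Adding an isolated node -/

section Isolated

variable {n : ℕ} {P : NetParams} {G : SimpleGraph (Fin n)}

theorem map_castSucc_adj {a b : Fin (n + 1)} :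
    (G.map Fin.castSucc).Adj a b ↔ ∃ x y, G.Adj x y ∧ x.castSucc = a ∧ y.castSucc = b :=
  map_adj Fin.castSuccEmb G a b

theorem map_castSucc_adj_castSucc {x y : Fin n} :
    (G.map Fin.castSucc).Adj x.castSucc y.castSucc ↔ G.Adj x y := by
  rw [map_castSucc_adj]
  constructor
  · rintro ⟨x', y', h, hx, hy⟩
    rwa [← Fin.castSucc_injective n hx, ← Fin.castSucc_injective n hy]
  · exact fun h => ⟨x, y, h, rfl, rfl⟩

theorem not_map_castSucc_adj_last {a : Fin (n + 1)} :
    ¬ (G.map Fin.castSucc).Adj a (Fin.last n) := by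
  rw [map_castSucc_adj]
  rintro ⟨x, y, -, -, hy⟩
  exact (Fin.castSucc_lt_last y).ne hy

theorem exists_walk_map_castSucc {y z : Fin n} (p : G.Walk y z) :
    ∃ q : (G.map Fin.castSucc).Walk y.castSucc z.castSucc,
      q.length = p.length ∧ q.support = p.support.map Fin.castSucc := by
  induction p with
  | nil => exact ⟨Walk.nil, by simp⟩
  | cons h p ih =>
    obtain ⟨q, h1, h2⟩ := ih
    exact ⟨Walk.cons (map_castSucc_adj_castSucc.2 h) q, by simp [h1], by simp [h2]⟩

theorem exists_walk_of_map_castSucc {a b : Fin (n + 1)} (p : (G.map Fin.castSucc).Walk a b)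
    {y z : Fin n} (ha : a = y.castSucc) (hb : b = z.castSucc) :
    ∃ q : G.Walk y z, p.length = q.length ∧ p.support = q.support.map Fin.castSucc := by
  induction p generalizing y with
  | nil =>
    obtain rfl := Fin.castSucc_injective n (ha.symm.trans hb)
    exact ⟨Walk.nil, by simp [ha]⟩
  | cons h p ih =>
    subst ha
    obtain ⟨x', y', hxy, hx, hy⟩ := map_castSucc_adj.1 h
    obtain rfl := Fin.castSucc_injective n hx
    obtain ⟨q, h1, h2⟩ := ih hy.symm hb
    exact ⟨Walk.cons hxy q, by simp [h1], by simp [h2]⟩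

theorem edist_map_castSucc (y z : Fin n) :
    (G.map Fin.castSucc).edist y.castSucc z.castSucc = G.edist y z := by
  apply le_antisymm
  · by_cases h : G.edist y z = ⊤
    · simp [h]
    · obtain ⟨p, hp⟩ := exists_walk_of_edist_ne_top h
      obtain ⟨q, hq, -⟩ := exists_walk_map_castSucc p
      rw [← hp, ← hq]
      exact edist_le q
  · by_cases h : (G.map Fin.castSucc).edist y.castSucc z.castSucc = ⊤
    · simp [h]
    · obtain ⟨p, hp⟩ := exists_walk_of_edist_ne_top h
      obtain ⟨q, hq, -⟩ := exists_walk_of_map_castSucc p rfl rfl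
      rw [← hp, hq]
      exact edist_le q

theorem edist_map_castSucc_last (y : Fin n) :
    (G.map Fin.castSucc).edist y.castSucc (Fin.last n) = ⊤ := by
  refine edist_eq_top_of_not_reachable ?_
  rintro ⟨p⟩
  have hp : ¬ p.Nil := fun hn => (Fin.castSucc_lt_last y).ne hn.eq
  exact not_map_castSucc_adj_last (p.adj_penultimate hp)

theorem castSucc_mem_essential {i y z : Fin n} :
    i.castSucc ∈ essential (G.map Fin.castSucc) y.castSucc z.castSucc ↔
      i ∈ essential G y z := by
  simp only [mem_essential, ne_eq, Fin.castSucc_inj]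
  refine and_congr_right fun _ => and_congr_right fun _ => ⟨fun h p => ?_, fun h p => ?_⟩
  · obtain ⟨q, -, hq⟩ := exists_walk_map_castSucc p
    have := h q
    rw [hq, List.mem_map_of_injective (Fin.castSucc_injective n)] at this
    exact this
  · obtain ⟨q, -, hq⟩ := exists_walk_of_map_castSucc p rfl rfl
    rw [hq, List.mem_map_of_injective (Fin.castSucc_injective n)]
    exact h q

theorem essential_map_castSucc {y z : Fin n} (h : G.edist y z ≠ ⊤) :
    essential (G.map Fin.castSucc) y.castSucc z.castSucc =
      (essential G y z).map Fin.castSuccEmb := by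
  ext a
  induction a using Fin.lastCases with
  | cast i => simp [castSucc_mem_essential]
  | last =>
    obtain ⟨p, -⟩ := exists_walk_of_edist_ne_top h
    obtain ⟨q, -, hq⟩ := exists_walk_map_castSucc p
    have h1 : Fin.last n ∉ essential (G.map Fin.castSucc) y.castSucc z.castSucc := fun h' => by
      have := (mem_essential.1 h').2.2 q
      rw [hq, List.mem_map] at this
      obtain ⟨b, -, hb⟩ := this
      exact (Fin.castSucc_lt_last b).ne hb
    simp [h1, (Fin.castSucc_lt_last _).ne]

theorem netBenefit_of_edist_eq_top {V : Type*} [Fintype V] {G : SimpleGraph V} {i w : V}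
    (h : G.edist i w = ⊤) : netBenefit P G i w = 0 := by
  simp [netBenefit, h, benefit]

theorem bridging_of_edist_eq_top {V : Type*} [Fintype V] {G : SimpleGraph V} {i y z : V}
    (h : G.edist y z = ⊤) : bridging P G i y z = 0 := by
  simp [bridging, h, benefit]

theorem netBenefit_map_castSucc (i w : Fin n) :
    netBenefit P (G.map Fin.castSucc) i.castSucc w.castSucc = netBenefit P G i w := by
  by_cases h : G.edist i w = ⊤
  · rw [netBenefit_of_edist_eq_top h,
      netBenefit_of_edist_eq_top ((edist_map_castSucc i w).trans h)]
  · simp only [netBenefit, edist_map_castSucc, essential_map_castSucc h, Finset.map_nonempty]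

theorem bridging_map_castSucc (i y z : Fin n) :
    bridging P (G.map Fin.castSucc) i.castSucc y.castSucc z.castSucc = bridging P G i y z := by
  by_cases h : G.edist y z = ⊤
  · rw [bridging_of_edist_eq_top h,
      bridging_of_edist_eq_top ((edist_map_castSucc y z).trans h)]
  · have hcard : (essential (G.map Fin.castSucc) y.castSucc z.castSucc).card =
        (essential G y z).card := by
      rw [essential_map_castSucc h, Finset.card_map]
    by_cases hi : i ∈ essential G y z
    · rw [bridging, bridging, if_pos hi, if_pos (castSucc_mem_essential.2 hi), hcard,
        edist_map_castSucc]
    · rw [bridging, bridging, if_neg hi, if_neg (castSucc_mem_essential.not.2 hi)]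

theorem degree_map_castSucc (i : Fin n)
    [Fintype ((G.map Fin.castSucc).neighborSet i.castSucc)] [Fintype (G.neighborSet i)] :
    (G.map Fin.castSucc).degree i.castSucc = G.degree i := by
  rw [← card_neighborFinset_eq_degree, ← card_neighborFinset_eq_degree,
    ← Finset.card_map (s := G.neighborFinset i) Fin.castSuccEmb]
  refine congrArg Finset.card ?_
  ext a
  rw [mem_neighborFinset]
  induction a using Fin.lastCases with
  | cast x => simp [map_castSucc_adj_castSucc]
  | last => simp [not_map_castSucc_adj_last, (Fin.castSucc_lt_last _).ne]

theorem utility_map_castSucc (i : Fin n) :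
    utility P (G.map Fin.castSucc) i.castSucc = utility P G i := by
  classical
  have hleft : ∀ y : Fin n,
      bridging P (G.map Fin.castSucc) i.castSucc (Fin.last n) y.castSucc = 0 :=
    fun y => by rw [bridging_comm, bridging_of_edist_eq_top (edist_map_castSucc_last y)]
  have hself : bridging P (G.map Fin.castSucc) i.castSucc (Fin.last n) (Fin.last n) = 0 := by
    simp [bridging, essential_self]
  rw [utility_eq, utility_eq, degree_map_castSucc]
  simp only [Fin.sum_univ_castSucc, netBenefit_map_castSucc, bridging_map_castSucc,
    netBenefit_of_edist_eq_top (edist_map_castSucc_last _),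
    bridging_of_edist_eq_top (edist_map_castSucc_last _), hleft, hself]
  simp

end Isolated

/-! ### The entry -/

section Entry

/-- An entrant with a single neighbour `t` reaches its own class at distance `2` and the rest of the
class of `t` at distance `3`, always at the price of the rent to `t`. -/
theorem Attaching.utility_entrant {V : Type*} [Fintype V] {P : NetParams} {side : V → Bool}
    {v t : V} (hA : Attaching side v {t}) (ht : side t = true) :
    utility P (stage side v {t}) v = P.b 1 - P.c +
      ((Fintype.card {a // side a = false} : ℝ) - 1) * ((1 - P.γ) * P.b 2) +
      ((Fintype.card {a // side a = true} : ℝ) - 1) * ((1 - P.γ) * P.b 3) := by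
  classical
  have hv := hA.side_entrant
  have htv := ne_of_side ht hv
  have htS : t ∈ ({t} : Finset V) := Finset.mem_singleton_self t
  have hvt := stage_adj_entrant hv htS ht
  have hnbr : ∀ x, (stage side v {t}).Adj v x → x = t := fun x h =>
    Finset.mem_singleton.1 (h.2.1 rfl)
  have hdeg : (stage side v {t}).degree v = 1 := by
    rw [← card_neighborFinset_eq_degree, Finset.card_eq_one]
    refine ⟨t, ?_⟩
    ext x
    rw [mem_neighborFinset, Finset.mem_singleton]
    exact ⟨hnbr x, fun h => h ▸ hvt⟩
  have hbr : ∑ y, ∑ z, bridging P (stage side v {t}) v y z = 0 := by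
    refine sum_bridging_eq_zero (not_mem_essential_of_hub (o := t) fun y hyv => ?_)
    by_cases hyt : y = t
    · subst hyt
      exact JoinedAvoiding.refl hyv
    cases hy : side y
    · exact JoinedAvoiding.of_adj hyv htv (stage_adj_of_mem hv htS ht hy).symm
    · obtain ⟨z, hzv, hz⟩ := hA.exists_false hy ht hyt
      exact (JoinedAvoiding.of_adj hyv hzv (stage_adj_of_ne (by simp [hy, hz]) hyv hzv)).trans
        (JoinedAvoiding.of_adj hzv htv (stage_adj_of_mem hv htS ht hz).symm)
  have hE : ∀ w, w ≠ v → w ≠ t → (essential (stage side v {t}) v w).Nonempty := by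
    intro w hwv hwt
    rw [essential_comm]
    exact ⟨t, mem_essential_of_pendant hwv hwt htv.symm hnbr⟩
  have hnet : ∀ w, netBenefit P (stage side v {t}) v w =
      ((if side w = true then (1 - P.γ) * P.b 3 else (1 - P.γ) * P.b 2) -
        if w = t then (1 - P.γ) * P.b 3 else 0) - if w = v then (1 - P.γ) * P.b 2 else 0 := by
    intro w
    by_cases hwv : w = v
    · subst hwv
      simp [netBenefit_self, hv, htv.symm]
    by_cases hwt : w = t
    · subst hwt
      simp [netBenefit_of_adj hvt, ht, htv]
    have hvw : ¬ (stage side v {t}).Adj v w := fun h => hwt (hnbr w h)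
    rw [netBenefit_of_nonempty (Ne.symm hwv) hvw (hE w hwv hwt), if_neg hwv, if_neg hwt,
      sub_zero, sub_zero]
    cases hw : side w
    · rw [hA.edist_eq_two (Ne.symm hwv) (hv.trans hw.symm), benefit_two]
      simp
    · obtain ⟨z, hzv, hz⟩ := hA.exists_false hw ht hwt
      have h3 : (stage side v {t}).edist v w = 3 := le_antisymm
        (edist_le_three hvt (stage_adj_of_mem hv htS ht hz)
          (stage_adj_of_ne (by simp [hw, hz]) hzv hwv))
        (three_le_edist_stage (by simp [hv, hw]) hvw)
      rw [h3, benefit_three]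
      simp
  rw [utility_eq, hdeg, hbr]
  simp only [hnet, Finset.sum_sub_distrib, Finset.sum_ite_eq', Finset.mem_univ, if_true]
  rw [Finset.sum_ite, Finset.sum_const, Finset.sum_const, Fintype.card_subtype,
    Fintype.card_subtype]
  simp only [nsmul_eq_mul, Bool.not_eq_true]
  push_cast
  ring

variable {n : ℕ} {P : NetParams} {G : SimpleGraph (Fin n)} {side : Fin n → Bool}

/-- The colouring after an entry through `t`: the class of `t` gets colour `true`, and the entrant
joins the other class. -/
def entrySide (side : Fin n → Bool) (t : Fin n) : Fin (n + 1) → Bool :=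
  Fin.lastCases false fun a => decide (side a = side t)

@[simp]
theorem entrySide_last (t : Fin n) : entrySide side t (Fin.last n) = false := by
  simp [entrySide]

@[simp]
theorem entrySide_castSucc (t a : Fin n) :
    entrySide side t a.castSucc = decide (side a = side t) := by
  simp [entrySide]

theorem card_entrySide_true (t : Fin n) :
    Fintype.card {a // entrySide side t a = true} = Fintype.card {a // side a = side t} := by
  simp only [Fintype.card_subtype, Finset.card_filter, Fin.sum_univ_castSucc]
  simp

theorem card_entrySide_false (t : Fin n) :
    Fintype.card {a // entrySide side t a = false} =
      Fintype.card {a // side a ≠ side t} + 1 := by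
  simp only [Fintype.card_subtype, Finset.card_filter, Fin.sum_univ_castSucc]
  simp

theorem enter_eq_stage (hG : ∀ a b, G.Adj a b ↔ side a ≠ side b) (t : Fin n) :
    enter G t = stage (entrySide side t) (Fin.last n) {t.castSucc} := by
  ext a b
  rw [enter, addLink_adj (Fin.castSucc_lt_last t).ne', stage_adj]
  induction a using Fin.lastCases with
  | last =>
    induction b using Fin.lastCases with
    | last => simp [(Fin.castSucc_lt_last t).ne']
    | cast b =>
      have h1 : ¬ (G.map Fin.castSucc).Adj (Fin.last n) b.castSucc :=
        fun h => not_map_castSucc_adj_last h.symm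
      have h2 := (Fin.castSucc_lt_last b).ne
      have h3 := (Fin.castSucc_lt_last t).ne'
      simp only [h1, h2, h3, true_and, false_and, false_or, or_false, entrySide_last,
        entrySide_castSucc, Finset.mem_singleton, Fin.castSucc_inj, forall_const,
        IsEmpty.forall_iff, and_true]
      constructor
      · rintro rfl
        simp
      · exact fun h => h.2
  | cast a =>
    induction b using Fin.lastCases with
    | last =>
      have h2 := (Fin.castSucc_lt_last a).ne
      have h3 := (Fin.castSucc_lt_last t).ne'
      simp only [not_map_castSucc_adj_last, h2, h3, and_true, false_and, false_or,
        entrySide_last, entrySide_castSucc, Finset.mem_singleton, Fin.castSucc_inj, forall_const,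
        IsEmpty.forall_iff, true_and]
      constructor
      · rintro rfl
        simp
      · exact fun h => h.2
    | cast b =>
      have h2 := (Fin.castSucc_lt_last a).ne
      have h3 := (Fin.castSucc_lt_last b).ne
      simp only [map_castSucc_adj_castSucc, hG, h2, h3, false_and, and_false, or_false,
        entrySide_castSucc, IsEmpty.forall_iff, and_true]
      cases side a <;> cases side b <;> cases side t <;> simp

theorem IsBalanced.card_eq_le (h : IsBalanced G side) (t : Fin n) :
    Fintype.card {a // side a = side t} ≤ Fintype.card {a // side a ≠ side t} + 1 := by
  have h1 := h.card_true_le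
  have h2 := h.card_false_le
  cases side t
  · simpa using h2
  · simpa using h1

theorem IsBalanced.attaching (h : IsBalanced G side) (t : Fin n) :
    Attaching (entrySide side t) (Fin.last n) {t.castSucc} := by
  refine ⟨by simp, ⟨t.castSucc, by simp, by simp⟩, ?_⟩
  rw [card_entrySide_true, card_entrySide_false]
  exact h.card_eq_le t

theorem acceptsEntry (hP : Admissible P) (t : Fin n) : AcceptsEntry P G t := by
  rw [AcceptsEntry, enter, ← utility_map_castSucc, addLink_comm]
  refine (utility_lt_addLink_of_three_le hP ?_).le
  rw [edist_map_castSucc_last]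
  exact le_top

theorem IsBalanced.degree_eq (h : IsBalanced G side) (t : Fin n) [Fintype (G.neighborSet t)] :
    G.degree t = Fintype.card {a // side a ≠ side t} := by
  rw [← card_neighborFinset_eq_degree, Fintype.card_subtype]
  congr 1
  ext a
  simp [h.adj_iff, eq_comm]

theorem IsBalanced.entryUtility_eq (h : IsBalanced G side) (t : Fin n) :
    entryUtility P G t = P.b 1 - P.c +
      (Fintype.card {a // side a ≠ side t} : ℝ) * ((1 - P.γ) * P.b 2 - P.c₀) +
      ((Fintype.card {a // side a = side t} : ℝ) - 1) * ((1 - P.γ) * P.b 3) := by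
  rw [entryUtility, enter_eq_stage h.adj_iff, (h.attaching t).utility_entrant (by simp),
    card_entrySide_true, card_entrySide_false, h.degree_eq]
  push_cast
  ring

theorem IsBalanced.exists_bestEntry (hP : Admissible P) (hc₀ : P.c₀ ≤ (1 - P.γ) * P.b 2)
    (h : IsBalanced G side) (hn : 1 ≤ n) : ∃ t, BestEntry P G t := by
  have : Nonempty (Fin n) := ⟨⟨0, hn⟩⟩
  obtain ⟨t, ht⟩ := Finite.exists_max fun t => entryUtility P G t
  refine ⟨t, acceptsEntry hP t, fun s _ => ht s, ?_⟩
  have hp : (1 : ℝ) ≤ Fintype.card {a // side a = side t} := by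
    have : 0 < Fintype.card {a // side a = side t} := Fintype.card_pos_iff.2 ⟨⟨t, rfl⟩⟩
    exact_mod_cast this
  have hb := hP.nonneg 3 (by norm_num)
  have h1 : 0 ≤ (Fintype.card {a // side a ≠ side t} : ℝ) * ((1 - P.γ) * P.b 2 - P.c₀) :=
    mul_nonneg (Nat.cast_nonneg _) (sub_nonneg.2 hc₀)
  have h2 : 0 ≤ ((Fintype.card {a // side a = side t} : ℝ) - 1) * ((1 - P.γ) * P.b 3) :=
    mul_nonneg (sub_nonneg.2 hp) (mul_nonneg (sub_nonneg.2 hP.rent_lt_one.le) hb)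
  have := hP.cost_upper
  rw [h.entryUtility_eq]
  linarith

/-- The fee `c₀ > (1 - γ) (b₂ - b₃)` makes the nodes of the larger class, whose degree is smaller,
the more attractive ones to enter through. -/
theorem IsBalanced.card_le_of_bestEntry (hP : Admissible P)
    (hc₀ : (1 - P.γ) * (P.b 2 - P.b 3) < P.c₀) (h : IsBalanced G side) {t : Fin n}
    (ht : BestEntry P G t) :
    Fintype.card {a // side a ≠ side t} ≤ Fintype.card {a // side a = side t} := by
  by_contra! hlt
  obtain ⟨⟨s, hs⟩⟩ := Fintype.card_pos_iff.1 ((Nat.zero_le _).trans_lt hlt)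
  have h1 : Fintype.card {a // side a ≠ side s} = Fintype.card {a // side a = side t} :=
    Fintype.card_congr (Equiv.subtypeEquivRight fun a => by
      revert hs
      cases side a <;> cases side s <;> cases side t <;> simp)
  have h2 : Fintype.card {a // side a = side s} = Fintype.card {a // side a ≠ side t} :=
    Fintype.card_congr (Equiv.subtypeEquivRight fun a => by
      revert hs
      cases side a <;> cases side s <;> cases side t <;> simp)
  have hle := ht.2.1 s (acceptsEntry hP s)
  rw [h.entryUtility_eq, h.entryUtility_eq, h1, h2] at hle
  have hlt' : (Fintype.card {a // side a = side t} : ℝ) < Fintype.card {a // side a ≠ side t} := by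
    exact_mod_cast hlt
  nlinarith [mul_pos (sub_pos.2 hlt') (sub_pos.2 hc₀)]

/-- A best entry leads into the class that keeps the network balanced. -/
theorem IsBalanced.isBalanced_of_full (hP : Admissible P)
    (hc₀ : (1 - P.γ) * (P.b 2 - P.b 3) < P.c₀) (h : IsBalanced G side) {t : Fin n}
    (ht : BestEntry P G t) {T : Finset (Fin (n + 1))}
    (hA : Attaching (entrySide side t) (Fin.last n) T)
    (hT : ∀ x, entrySide side t x = true → x ∈ T) :
    IsBalanced (stage (entrySide side t) (Fin.last n) T) (entrySide side t) := by
  refine isBalanced_stage hA hT ?_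
  rw [card_entrySide_true, card_entrySide_false]
  exact Nat.succ_le_succ (h.card_le_of_bestEntry hP hc₀ ht)

theorem isBalanced_bot : IsBalanced (⊥ : SimpleGraph (Fin 1)) fun _ => true :=
  ⟨by simp, by simp, by simp⟩

theorem Emerges.isBalanced (hP : Admissible P) (hc₀ : (1 - P.γ) * (P.b 2 - P.b 3) < P.c₀)
    {n : ℕ} {G : SimpleGraph (Fin n)} (h : Emerges P n G) : ∃ side, IsBalanced G side := by
  induction h with
  | base => exact ⟨_, isBalanced_bot⟩
  | @grow n G t H _ ht hreach hstable ih =>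
    obtain ⟨side, hside⟩ := ih
    rw [enter_eq_stage hside.adj_iff] at hreach
    obtain ⟨T, hA, rfl⟩ := (hside.attaching t).reflTransGen hP hreach
    exact ⟨_, hside.isBalanced_of_full hP hc₀ ht hA fun x hx =>
      hA.mem_of_pairwiseStable hP hstable hx⟩

theorem Emerges.pairwiseStable {n : ℕ} {G : SimpleGraph (Fin n)} (h : Emerges P n G) :
    PairwiseStable P G := by
  cases h with
  | base => exact ⟨fun i j h => absurd h (by simp), fun i j h => absurd (Subsingleton.elim i j) h⟩
  | grow _ _ _ h => exact h

theorem exists_emerges (hP : Admissible P) (hc₀ : (1 - P.γ) * (P.b 2 - P.b 3) < P.c₀)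
    (hc₀' : P.c₀ ≤ (1 - P.γ) * P.b 2) {n : ℕ} (hn : 1 ≤ n) :
    ∃ G : SimpleGraph (Fin n), Emerges P n G := by
  induction n, hn using Nat.le_induction with
  | base => exact ⟨⊥, Emerges.base⟩
  | succ n hn ih =>
    obtain ⟨G, hG⟩ := ih
    obtain ⟨side, hside⟩ := hG.isBalanced hP hc₀
    obtain ⟨t, ht⟩ := hside.exists_bestEntry hP hc₀' hn
    obtain ⟨T, hA, hT, hreach⟩ := (hside.attaching t).exists_reflTransGen hP
    exact ⟨_, hG.grow ht (by rwa [enter_eq_stage hside.adj_iff]) (hA.pairwiseStable hP hT)⟩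

end Entry

end NetFormation

theorem mainTheorem2 (P : NetParams)
    (hb_nonneg : ∀ i, 1 ≤ i → 0 ≤ P.b i)
    (hb_decay : ∀ i, 1 ≤ i → P.b (i + 1) < P.b i)
    (hγ_nonneg : 0 ≤ P.γ) (hγ_lt_one : P.γ < 1)
    (hγ : P.γ < (P.b 2 - P.b 3) / (3 * P.b 2 - P.b 3))
    (hc_lower : P.b 1 - P.b 2 + P.γ * (3 * P.b 2 - P.b 3) < P.c)
    (hc_upper : P.c < P.b 1 - P.b 3)
    (hc₀_lower : (1 - P.γ) * (P.b 2 - P.b 3) < P.c₀)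
    (hc₀_upper : P.c₀ ≤ (1 - P.γ) * P.b 2) :
    ∀ n : ℕ, 1 ≤ n →
      (∃ G : SimpleGraph (Fin n), NetFormation.Emerges P n G) ∧
      ∀ G : SimpleGraph (Fin n), NetFormation.Emerges P n G →
        NetFormation.PairwiseStable P G ∧
        Nonempty (G ≃g SimpleGraph.turanGraph n 2) ∧
        (∃ t : Fin n, NetFormation.BestEntry P G t) ∧
        ∀ t : Fin n, NetFormation.BestEntry P G t →
          ∀ (m : ℕ → Fin (n + 1)) (g : ℕ → SimpleGraph (Fin (n + 1))),
            NetFormation.FairSchedule m →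
            NetFormation.IsRun P (NetFormation.enter G t) m g →
            ∃ (H : SimpleGraph (Fin (n + 1))) (T : ℕ),
              (∀ k, T ≤ k → g k = H) ∧
              NetFormation.PairwiseStable P H ∧
              Nonempty (H ≃g SimpleGraph.turanGraph (n + 1) 2) := by
  have hP : NetFormation.Admissible P :=
    ⟨hb_nonneg, hb_decay, hγ_nonneg, hγ_lt_one, hc_lower, hc_upper⟩
  intro n hn
  refine ⟨NetFormation.exists_emerges hP hc₀_lower hc₀_upper hn, fun G hG => ?_⟩
  obtain ⟨side, hside⟩ := hG.isBalanced hP hc₀_lower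
  refine ⟨hG.pairwiseStable, hside.nonempty_iso_turanGraph,
    hside.exists_bestEntry hP hc₀_upper hn, fun t ht m g hm hg => ?_⟩
  obtain ⟨T, U, hA, hT, hU⟩ := (hside.attaching t).exists_eventually_eq hP hm hg.2
    (hg.1.trans (NetFormation.enter_eq_stage hside.adj_iff t))
  exact ⟨_, U, hU, hA.pairwiseStable hP hT,
    (hside.isBalanced_of_full hP hc₀_lower ht hA hT).nonempty_iso_turanGraph⟩
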